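/- **Model.** Let $K,m\ge 1$ be integers and $\lambda,\mu>0$. The reliability state $\theta(t)$ is an irreducible continuous-time Markov chain on $\Theta=\{1,\dots,K\}$ with generator $Q$ and stationary distribution $(\pi_\theta)_{\theta\in\Theta}$. Tasks arrive according to a Poisson process of rate $\lambda$, with i.i.d. risk scores $S\in[0,1]$ that have a density which is continuous and strictly positive on $(0,1)$. The cost $c_{\text{auto}}:[0,1]\times\Theta\to\mathbb{R}_+$ is strictly increasing, continuous and convex in $s$, non-decreasing in $\theta$, and has increasing differences in $(s,\theta)$. At each arrival a policy decides whether to automate the task or to escalate it to a queue with $m$ parallel servers and an infinite buffer, with independent exponential service times of rate $\mu$; $q(t)$ is the number of tasks in the queue (waiting or in service). The arrivals, scores, services and reliability state are driven by independent sources of randomness. The decision of an admissible policy may depend on the whole history of the system, on the current values of $q$ and $\theta$, and on the score $s$ of the arriving task; the policy is stationary if the decision is a fixed function of $(q,\theta,s)$. For $\epsilon\ge 0$ put $$\bar T(\theta)=\sup\{\tau\in[0,1]:\mathbb{E}[\mathbf 1(S<\tau)\,c_{\text{auto}}(S,\theta)]\le\epsilon\},\qquad \lambda_{\min}(\theta)=\lambda\,\mathbb{P}(S\ge\bar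 T(\theta)),\qquad \Lambda_{\text{req}}=\sum_{\theta\in\Theta}\pi_\theta\,\lambda_{\min}(\theta).$$ A policy is $\epsilon$-safe if it never automates a task with score $s>\bar T(\theta)$, where $\theta$ is the reliability state at its arrival. **Theorem (Capacity Phase Transition).** 1. *Stable region.* If $\Lambda_{\text{req}}<m\mu$, there is a stationary $\epsilon$-safe policy with a finite expected queue length: under it, the process $(q(t),\theta(t))$ has exactly one stationary distribution, $\mathbb{E}[q]<\infty$ under this distribution, and $\sup_{t\ge 0}\mathbb{E}[q(t)]<\infty$ from every initial state. 2. *Unstable region.* If $\Lambda_{\text{req}}>m\mu$, then for every admissible policy and every initial state $(q_0,\theta_0)$, at least one of the following holds: - the system is unstable: $\lim_{t\to\infty}\mathbb{P}(q(t)>k)=1$ for every $k\in\mathbb{N}$; - the policy violates $\epsilon$-safety on a set of positive measure: with positive probability, at some arrival it automates a task with score $s>\bar T(\theta)$. -/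

import Mathlib

open MeasureTheory ProbabilityTheory Filter Topology Set
open scoped ENNReal

noncomputable section

namespace HybridQueue

/-- The primitives of the hybrid system with `K` reliability states and `m` human experts. The
reliability states `1, …, K` of the model are the elements of `Fin K`, in the same order. -/
structure HybridSystem (K m : ℕ) where
  /-- there is at least one reliability state -/
  states_pos : 0 < K
  /-- there is at least one human expert -/
  servers_pos : 0 < m
  /-- arrival rate `λ` of tasks -/
  lam : ℝ
  lam_pos : 0 < lam
  /-- service rate `μ` of one expert -/
  mu : ℝ
  mu_pos : 0 < mu
  /-- density of the risk scores, which take values in `[0, 1]` -/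
  density : ℝ → ℝ
  density_continuous : ContinuousOn density (Ioo 0 1)
  density_pos : ∀ s ∈ Ioo (0 : ℝ) 1, 0 < density s
  density_total : ∫⁻ s in Ioo (0 : ℝ) 1, ENNReal.ofReal (density s) = 1
  /-- generator of the reliability drift -/
  Q : Matrix (Fin K) (Fin K) ℝ
  Q_offDiag_nonneg : ∀ i j, i ≠ j → 0 ≤ Q i j
  Q_row_sum : ∀ i, ∑ j, Q i j = 0
  /-- the drift is irreducible: every state can be reached from every state -/
  Q_irreducible : ∀ i j, Relation.ReflTransGen (fun a b => a ≠ b ∧ 0 < Q a b) i j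
  /-- expected cost `cAuto s θ` of automating a task with score `s` in reliability state `θ` -/
  cAuto : ℝ → Fin K → ℝ
  cAuto_nonneg : ∀ θ, ∀ s ∈ Icc (0 : ℝ) 1, 0 ≤ cAuto s θ
  cAuto_strictMono : ∀ θ, StrictMonoOn (fun s => cAuto s θ) (Icc 0 1)
  cAuto_continuous : ∀ θ, ContinuousOn (fun s => cAuto s θ) (Icc 0 1)
  cAuto_convex : ∀ θ, ConvexOn ℝ (Icc 0 1) (fun s => cAuto s θ)
  cAuto_drift_mono : ∀ s ∈ Icc (0 : ℝ) 1, ∀ θ θ', θ < θ' → cAuto s θ ≤ cAuto s θ'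
  cAuto_supermodular : ∀ s ∈ Icc (0 : ℝ) 1, ∀ s' ∈ Icc (0 : ℝ) 1, ∀ θ θ', s < s' → θ < θ' →
    cAuto s' θ - cAuto s θ ≤ cAuto s' θ' - cAuto s θ'

/-- State `(q, θ)`: number of tasks in the human queue (waiting or in service), and reliability
state. -/
abbrev State (K : ℕ) := ℕ × Fin K

/-- The exponential clocks that drive the system: one for the task arrivals, one for each of the `m`
experts (rate `μ`), and one for each pair `(i, j)` of reliability states (rate `Q i j`). -/
abbrev Clock (K m : ℕ) := Unit ⊕ Fin m ⊕ (Fin K × Fin K)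

/-- One event: the time elapsed since the preceding event, the clock that rings, and the risk score
that the arriving task has if it is the arrival clock that rings. -/
abbrev Mark (K m : ℕ) := ℝ × Clock K m × ℝ

/-- An admissible policy. At the event number `n` (if it is an arrival), the action is a function of
all earlier events, of the time elapsed since the last of them, of the current state `(q, θ)` and of
the risk score `s` of the arriving task; `true` means escalate and `false` means automate.
The earlier events, together with the initial state, determine the earlier states and actions, so
that every rule that depends on the history of the process is of this form. -/
structure Policy (K m : ℕ) where
  act : (n : ℕ) → (Fin n → Mark K m) × ℝ × ℕ × Fin K × ℝ → Bool
  measurable_act : ∀ n, Measurable (act n)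

/-- A stationary Markovian policy: the action is a function of `(q, θ, s)`. -/
structure StationaryPolicy (K : ℕ) where
  act : ℕ → Fin K → ℝ → Bool
  measurable_act : ∀ q θ, Measurable (act q θ)

/-- A stationary Markovian policy is an admissible policy. -/
def StationaryPolicy.toPolicy {K : ℕ} (p : StationaryPolicy K) (m : ℕ) : Policy K m where
  act _ h := p.act h.2.2.1 h.2.2.2.1 h.2.2.2.2
  measurable_act n := by
    have h : Measurable (fun y : (ℕ × Fin K) × ℝ => p.act y.1.1 y.1.2 y.2) :=
      measurable_from_prod_countable_right (fun x => p.measurable_act x.1 x.2)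
    exact h.comp (g := fun y : (ℕ × Fin K) × ℝ => p.act y.1.1 y.1.2 y.2)
      (f := fun h : (Fin n → Mark K m) × ℝ × ℕ × Fin K × ℝ =>
        ((h.2.2.1, h.2.2.2.1), h.2.2.2.2)) (by fun_prop)

/-- State after an event. `a` is the action taken if the event is an arrival. A ring of the clock of
expert `j` completes a service if and only if more than `j` tasks are present, so that in state
`(q, θ)` services are completed at rate `min q m * μ`. A ring of the clock `(i, j)` moves the
reliability state from `i` to `j`. -/
def step {K m : ℕ} (a : Bool) (c : Clock K m) (x : State K) : State K :=
  match c with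
  | Sum.inl _ => if a then (x.1 + 1, x.2) else x
  | Sum.inr (Sum.inl j) => if (j : ℕ) < x.1 then (x.1 - 1, x.2) else x
  | Sum.inr (Sum.inr (i, j)) => if x.2 = i then (x.1, j) else x

/-- The action that policy `p` takes in state `x` if the event number `n` is an arrival. -/
def Policy.action {K m : ℕ} (p : Policy K m) (ω : ℕ → Mark K m) (n : ℕ) (x : State K) : Bool :=
  p.act n (fun i => ω i, (ω n).1, x.1, x.2, (ω n).2.2)

/-- State just before the event number `n`, started from `x₀`. -/
def Policy.chain {K m : ℕ} (p : Policy K m) (x₀ : State K) (ω : ℕ → Mark K m) : ℕ → State K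
  | 0 => x₀
  | n + 1 => step (p.action ω n (p.chain x₀ ω n)) (ω n).2.1 (p.chain x₀ ω n)

/-- Time of the event number `n`. -/
def eventTime {K m : ℕ} (ω : ℕ → Mark K m) (n : ℕ) : ℝ := ∑ i ∈ Finset.range (n + 1), (ω i).1

/-- Number of events in `[0, t]` (finite almost surely). -/
def eventCount {K m : ℕ} (ω : ℕ → Mark K m) (t : ℝ) : ℕ := {n | eventTime ω n ≤ t}.ncard

/-- The state process `x(t) = (q(t), θ(t))`, started from `x₀`. -/
def Policy.process {K m : ℕ} (p : Policy K m) (x₀ : State K) (t : ℝ) (ω : ℕ → Mark K m) :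
    State K :=
  p.chain x₀ ω (eventCount ω t)

namespace HybridSystem

variable {K m : ℕ} (M : HybridSystem K m)

/-- Law of the risk scores. -/
def scoreLaw : Measure ℝ :=
  (volume.restrict (Ioo (0 : ℝ) 1)).withDensity (fun s => ENNReal.ofReal (M.density s))

instance : IsProbabilityMeasure M.scoreLaw :=
  ⟨by rw [scoreLaw, withDensity_apply _ MeasurableSet.univ, Measure.restrict_univ]
      exact M.density_total⟩

/-- Rate of each clock. -/
def rate : Clock K m → ℝ
  | Sum.inl _ => M.lam
  | Sum.inr (Sum.inl _) => M.mu
  | Sum.inr (Sum.inr (i, j)) => if i = j then 0 else M.Q i j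

/-- Total rate of all clocks. -/
def totalRate : ℝ := ∑ c, M.rate c

lemma rate_nonneg (c : Clock K m) : 0 ≤ M.rate c := by
  rcases c with _ | _ | ⟨i, j⟩
  · exact M.lam_pos.le
  · exact M.mu_pos.le
  · simp only [rate]
    split_ifs with h
    · exact le_rfl
    · exact M.Q_offDiag_nonneg i j h

lemma totalRate_pos : 0 < M.totalRate :=
  Finset.sum_pos' (fun c _ => M.rate_nonneg c) ⟨Sum.inl (), Finset.mem_univ _, M.lam_pos⟩

/-- Law of the clock that rings at an event: probability proportional to its rate. -/
def clockLaw : Measure (Clock K m) :=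
  ∑ c, ENNReal.ofReal (M.rate c / M.totalRate) • Measure.dirac c

instance : IsProbabilityMeasure M.clockLaw :=
  ⟨by
    simp only [clockLaw, Measure.coe_finsetSum, Finset.sum_apply, Measure.smul_apply,
      Measure.dirac_apply_of_mem (mem_univ _), smul_eq_mul, mul_one]
    rw [← ENNReal.ofReal_sum_of_nonneg
      (fun c _ => div_nonneg (M.rate_nonneg c) M.totalRate_pos.le), ← Finset.sum_div]
    change ENNReal.ofReal (M.totalRate / M.totalRate) = 1
    rw [div_self M.totalRate_pos.ne', ENNReal.ofReal_one]⟩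

instance : IsProbabilityMeasure (expMeasure M.totalRate) :=
  isProbabilityMeasure_expMeasure M.totalRate_pos

/-- The probability that drives the system: the events are independent, the times between them are
exponential with the total rate, and these times, the clocks that ring and the risk scores are
independent. Equivalently, the clocks are independent Poisson processes with their rates, and the
tasks have independent scores with law `scoreLaw`. -/
def prob : Measure (ℕ → Mark K m) :=
  Measure.infinitePi fun _ => (expMeasure M.totalRate).prod (M.clockLaw.prod M.scoreLaw)

/-- `w` is a stationary distribution of the reliability drift. -/
def IsDriftStationary (w : Fin K → ℝ) : Prop :=
  (∀ θ, 0 ≤ w θ) ∧ ∑ θ, w θ = 1 ∧ ∀ θ', ∑ θ, w θ * M.Q θ θ' = 0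

/-- The maximum permissible threshold
`sup {τ ∈ [0, 1] : E[1(S < τ) * cAuto(S, θ)] ≤ ε}`. -/
def maxThreshold (ε : ℝ) (θ : Fin K) : ℝ :=
  sSup {τ : ℝ | τ ∈ Icc (0 : ℝ) 1 ∧
    ∫ s, (Iio τ).indicator (fun s => M.cAuto s θ) s ∂M.scoreLaw ≤ ε}

/-- The minimal safe escalation rate `λ * P(S ≥ maxThreshold ε θ)` in state `θ`. -/
def lamMin (ε : ℝ) (θ : Fin K) : ℝ := M.lam * M.scoreLaw.real (Ici (M.maxThreshold ε θ))

/-- The long-run average required capacity, for the stationary distribution `w` of the drift. -/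
def requiredCapacity (ε : ℝ) (w : Fin K → ℝ) : ℝ := ∑ θ, w θ * M.lamMin ε θ

/-- A stationary policy is `ε`-safe if it never automates a task with a score above the maximum
permissible threshold. -/
def IsSafe (ε : ℝ) (p : StationaryPolicy K) : Prop :=
  ∀ q θ, ∀ s ∈ Icc (0 : ℝ) 1, M.maxThreshold ε θ < s → p.act q θ s = true

/-- The event that, started from `x₀`, policy `p` at some time automates a task with a score above
the maximum permissible threshold. -/
def unsafeEvent (ε : ℝ) (p : Policy K m) (x₀ : State K) : Set (ℕ → Mark K m) :=
  {ω | ∃ n, (ω n).2.1 = Sum.inl () ∧ M.maxThreshold ε (p.chain x₀ ω n).2 < (ω n).2.2 ∧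
    p.action ω n (p.chain x₀ ω n) = false}

/-- Law of `x(t)` under policy `p`, started from `x₀`. -/
def law (p : Policy K m) (t : ℝ) (x₀ : State K) : Measure (State K) :=
  M.prob.map (p.process x₀ t)

/-- `ν` is a stationary distribution of the state process under the stationary policy `p`. -/
def IsStationaryLaw (p : StationaryPolicy K) (ν : Measure (State K)) : Prop :=
  IsProbabilityMeasure ν ∧ ∀ t : ℝ, 0 ≤ t → ν.bind (M.law (p.toPolicy m) t) = ν

/-- The system is unstable under `p`, started from `x₀`: `P(q(t) > k) → 1` for every `k`. -/
def IsUnstable (p : Policy K m) (x₀ : State K) : Prop :=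
  ∀ k : ℕ, Tendsto (fun t : ℝ => M.law p t x₀ {x | k < x.1}) atTop (𝓝 1)

/-- Finite expected queue length under the stationary policy `p`: there is exactly one stationary
distribution, the mean queue length under it is finite, and from each initial state the mean queue
length stays bounded in time. -/
def HasFiniteMeanQueue (p : StationaryPolicy K) : Prop :=
  (∃ ν, M.IsStationaryLaw p ν ∧ (∀ ν', M.IsStationaryLaw p ν' → ν' = ν) ∧
    ∫⁻ x, (x.1 : ℝ≥0∞) ∂ν < ∞) ∧
  ∀ x₀ : State K, ∃ C : ℝ≥0∞, C < ∞ ∧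
    ∀ t : ℝ, 0 ≤ t → ∫⁻ x, (x.1 : ℝ≥0∞) ∂(M.law (p.toPolicy m) t x₀) ≤ C

end HybridSystem

end HybridQueue

end

/-! All clocks ring at constant rates, also those of idle experts, so the total event rate does not
depend on the state. Hence under a stationary policy the state at events is an iteration of i.i.d.
random maps, independent of the event times, and the law at time `t` is a mixture of the laws of
this embedded chain.

The modulation by `θ` is averaged out by the Poisson equation `Q f = Λ_req - lamMin`, solvable
because the right side has mean zero under `w` and harmonic functions of an irreducible drift are
constant. Consider forced escalations minus rings of the service clocks, plus `f θ`. The mean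
increment of this quantity at an event is `(Λ_req - m μ) / totalRate` in every reliability state
(`integral_increment`). Increments are bounded, so a mean of strict sign gives an exponential moment
below one (`exists_lintegral_exp_le`).

Above capacity, this net count does not depend on the policy, it bounds the queue from below as long
as safety holds, and its exponential supermartingale shows that it tends to infinity almost surely.
So an almost surely safe policy is unstable, however it uses the history.

Below capacity, the policy that escalates only what safety forces has the net count as its exact
queue increment when all servers are busy. Thus `exp (η (q + f θ))` satisfies a geometric drift
condition, which bounds the mean queue. Two copies with the same randomness can meet from every pair
of states, and together with the drift this makes the mean meeting time finite
(`exists_coupling_lyapunov`). Backward iteration then converges almost surely to a variable with an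
invariant law, and forward coalescence gives uniqueness (`hasFiniteMeanQueue_of_drift`). -/

noncomputable section

namespace HybridQueue

/-! ### Iterated i.i.d. random maps and drift conditions -/

section RandomIteration

variable {E X : Type*}

/-- The sequence `x, φ (ω 0) x, φ (ω 1) (φ (ω 0) x), …`. -/
def forwardIter (φ : E → X → X) (x : X) (ω : ℕ → E) : ℕ → X
  | 0 => x
  | n + 1 => φ (ω n) (forwardIter φ x ω n)

/-- The backward composition `φ (ω 0) (φ (ω 1) (… (φ (ω (n - 1)) x)))`. -/
def backwardIter (φ : E → X → X) (ω : ℕ → E) : ℕ → X → X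
  | 0, x => x
  | n + 1, x => backwardIter φ ω n (φ (ω n) x)

/-- Two copies of the random map `φ`, driven by the same randomness. -/
def coupledMap (φ : E → X → X) (e : E) (z : X × X) : X × X := (φ e z.1, φ e z.2)

variable {φ : E → X → X}

lemma forwardIter_congr (x : X) {ω ω' : ℕ → E} (n : ℕ) (h : ∀ i < n, ω i = ω' i) :
    forwardIter φ x ω n = forwardIter φ x ω' n := by
  induction n with
  | zero => rfl
  | succ n ih =>
    simp only [forwardIter]
    rw [ih fun i hi => h i (by omega), h n (by omega)]

lemma backwardIter_congr {ω ω' : ℕ → E} (n : ℕ) (x : X) (h : ∀ i < n, ω i = ω' i) :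
    backwardIter φ ω n x = backwardIter φ ω' n x := by
  induction n generalizing x with
  | zero => rfl
  | succ n ih =>
    simp only [backwardIter]
    rw [ih _ fun i hi => h i (by omega), h n (by omega)]

lemma forwardIter_coupledMap (x y : X) (ω : ℕ → E) (n : ℕ) :
    forwardIter (coupledMap φ) (x, y) ω n = (forwardIter φ x ω n, forwardIter φ y ω n) := by
  induction n with
  | zero => rfl
  | succ n ih => simp only [forwardIter, ih, coupledMap]

lemma backwardIter_coupledMap (x y : X) (ω : ℕ → E) (n : ℕ) :
    backwardIter (coupledMap φ) ω n (x, y) = (backwardIter φ ω n x, backwardIter φ ω n y) := by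
  induction n generalizing x y with
  | zero => rfl
  | succ n ih => simp only [backwardIter, coupledMap, ih]

variable [MeasurableSpace E]

/-- The transition operator of the random map `φ`. -/
def transition (κ : Measure E) (φ : E → X → X) (g : X → ℝ≥0∞) (x : X) : ℝ≥0∞ :=
  ∫⁻ e, g (φ e x) ∂κ

/-- Independent and identically distributed sequences with marginal law `κ`. -/
abbrev iidLaw (κ : Measure E) : Measure (ℕ → E) := Measure.infinitePi fun _ => κ

/-- Cylinder sets determine the product law, and on a cylinder the resampled coordinate contributes
the same factor as the original one. This reduces independence of one coordinate to Tonelli. -/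
lemma measurePreserving_update (κ : Measure E) [IsProbabilityMeasure κ] (n : ℕ) :
    MeasurePreserving (fun z : E × (ℕ → E) => Function.update z.2 n z.1)
      (κ.prod (iidLaw κ)) (iidLaw κ) := by
  have hm : Measurable (fun z : E × (ℕ → E) => Function.update z.2 n z.1) := by
    rw [measurable_pi_iff]
    intro i
    by_cases h : i = n
    · subst h; simpa using measurable_fst
    · simp only [Function.update_of_ne h]
      exact (measurable_pi_apply i).comp measurable_snd
  refine ⟨hm, Measure.eq_infinitePi _ fun s t ht => ?_⟩
  rw [Measure.map_apply hm (MeasurableSet.pi s.countable_toSet fun i _ => ht i)]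
  by_cases hn : n ∈ s
  · have : (fun z : E × (ℕ → E) => Function.update z.2 n z.1) ⁻¹' (Set.pi s t)
        = t n ×ˢ Set.pi (s.erase n : Finset ℕ) t := by
      ext ⟨e, ω⟩
      simp only [mem_preimage, Set.mem_pi, Finset.mem_coe, mem_prod, Finset.mem_erase]
      constructor
      · intro h
        refine ⟨by simpa using h n hn, fun i hi => ?_⟩
        simpa [Function.update_of_ne hi.1] using h i hi.2
      · rintro ⟨h1, h2⟩ i hi
        by_cases h : i = n
        · subst h; simpa using h1
        · simpa [Function.update_of_ne h] using h2 i ⟨h, hi⟩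
    rw [this, Measure.prod_prod, Measure.infinitePi_pi _ (fun i _ => ht i),
      Finset.mul_prod_erase s (fun i => κ (t i)) hn]
  · have : (fun z : E × (ℕ → E) => Function.update z.2 n z.1) ⁻¹' (Set.pi s t)
        = univ ×ˢ Set.pi s t := by
      ext ⟨e, ω⟩
      simp only [mem_preimage, Set.mem_pi, Finset.mem_coe, mem_prod, mem_univ, true_and]
      refine forall₂_congr fun i hi => ?_
      rw [Function.update_of_ne (by rintro rfl; exact hn hi)]
    rw [this, Measure.prod_prod, measure_univ, one_mul,
      Measure.infinitePi_pi _ (fun i _ => ht i)]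

/-- The `n`-th coordinate is independent of everything that does not depend on it. -/
lemma lintegral_coordinate (κ : Measure E) [IsProbabilityMeasure κ] (n : ℕ)
    (F : E → (ℕ → E) → ℝ≥0∞) (hF : Measurable (Function.uncurry F))
    (hn : ∀ e e' ω, F e (Function.update ω n e') = F e ω) :
    ∫⁻ ω, F (ω n) ω ∂(iidLaw κ) = ∫⁻ e, ∫⁻ ω, F e ω ∂(iidLaw κ) ∂κ := by
  have hm : Measurable fun ω : ℕ → E => F (ω n) ω := by
    have h : Measurable fun ω : ℕ → E => (ω n, ω) := (measurable_pi_apply n).prodMk measurable_id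
    exact hF.comp h
  have hm' : Measurable fun z : E × (ℕ → E) =>
      F (Function.update z.2 n z.1 n) (Function.update z.2 n z.1) :=
    hm.comp (measurePreserving_update κ n).measurable
  rw [← (measurePreserving_update κ n).lintegral_comp hm, lintegral_prod _ hm'.aemeasurable]
  simp only [Function.update_self, hn]

variable [MeasurableSpace X] (hφ : Measurable (Function.uncurry φ))

include hφ

lemma measurable_coupledMap : Measurable (Function.uncurry (coupledMap φ)) :=
  (hφ.comp (measurable_fst.prodMk measurable_snd.fst)).prodMk
    (hφ.comp (measurable_fst.prodMk measurable_snd.snd))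

lemma measurable_forwardIter (x : X) (n : ℕ) : Measurable fun ω => forwardIter φ x ω n := by
  induction n with
  | zero => exact measurable_const
  | succ n ih => exact hφ.comp ((measurable_pi_apply n).prodMk ih)

lemma measurable_comp_forwardIter {g : X → ℝ≥0∞} (hg : Measurable g) (x : X) (n : ℕ) :
    Measurable fun ω => g (forwardIter φ x ω n) :=
  hg.comp (measurable_forwardIter hφ x n)

lemma measurable_backwardIter (n : ℕ) :
    Measurable fun z : (ℕ → E) × X => backwardIter φ z.1 n z.2 := by
  induction n with
  | zero => exact measurable_snd
  | succ n ih =>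
    exact ih.comp (measurable_fst.prodMk
      (hφ.comp (((measurable_pi_apply n).comp measurable_fst).prodMk measurable_snd)))

variable (κ : Measure E) [IsProbabilityMeasure κ]

lemma measurable_transition {g : X → ℝ≥0∞} (hg : Measurable g) :
    Measurable (transition κ φ g) :=
  (hg.comp (hφ.comp measurable_swap)).lintegral_prod_right'

/-- The Markov property: the state after `n` steps uses only the coordinates before `n`, so
coordinate `n` can be integrated out separately. -/
lemma lintegral_forwardIter_succ {g : X → ℝ≥0∞} (hg : Measurable g) (x : X) (n : ℕ) :
    ∫⁻ ω, g (forwardIter φ x ω (n + 1)) ∂(iidLaw κ)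
      = ∫⁻ ω, transition κ φ g (forwardIter φ x ω n) ∂(iidLaw κ) := by
  have hm : Measurable (Function.uncurry fun (e : E) (ω : ℕ → E) =>
      g (φ e (forwardIter φ x ω n))) :=
    hg.comp (hφ.comp (measurable_fst.prodMk ((measurable_forwardIter hφ x n).comp measurable_snd)))
  refine (lintegral_coordinate κ n (fun e ω => g (φ e (forwardIter φ x ω n))) hm
    fun e e' ω => ?_).trans ?_
  · rw [forwardIter_congr x n fun i hi => Function.update_of_ne hi.ne _ _]
  · exact lintegral_lintegral_swap hm.aemeasurable

lemma lintegral_forwardIter {g : X → ℝ≥0∞} (hg : Measurable g) (x : X) (n : ℕ) :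
    ∫⁻ ω, g (forwardIter φ x ω n) ∂(iidLaw κ) = (transition κ φ)^[n] g x := by
  induction n generalizing g with
  | zero => simp [forwardIter]
  | succ n ih =>
    rw [lintegral_forwardIter_succ hφ κ hg, ih (measurable_transition hφ κ hg),
      Function.iterate_succ_apply]

lemma lintegral_backwardIter_random {h : E → X → X} (hh : Measurable (Function.uncurry h))
    {g : X → ℝ≥0∞} (hg : Measurable g) (x : X) (n : ℕ) :
    ∫⁻ ω, g (backwardIter φ ω n (h (ω n) x)) ∂(iidLaw κ)
      = ∫⁻ e, ∫⁻ ω, g (backwardIter φ ω n (h e x)) ∂(iidLaw κ) ∂κ := by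
  refine lintegral_coordinate κ n (fun e ω => g (backwardIter φ ω n (h e x))) ?_ fun e e' ω => ?_
  · exact hg.comp ((measurable_backwardIter hφ n).comp
      (measurable_snd.prodMk (hh.comp (measurable_fst.prodMk measurable_const))))
  · rw [backwardIter_congr n _ fun i hi => Function.update_of_ne hi.ne _ _]

/-- Reversing the order of finitely many i.i.d. maps preserves the law of their composition, so for
fixed `n` backward and forward iterates have the same law. Backward iterates, however, can converge
pointwise where forward ones keep moving. -/
lemma lintegral_backwardIter {g : X → ℝ≥0∞} (hg : Measurable g) (x : X) (n : ℕ) :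
    ∫⁻ ω, g (backwardIter φ ω n x) ∂(iidLaw κ) = (transition κ φ)^[n] g x := by
  induction n generalizing x with
  | zero => simp [backwardIter]
  | succ n ih =>
    simp only [backwardIter]
    rw [lintegral_backwardIter_random hφ κ hφ hg, Function.iterate_succ_apply']
    exact lintegral_congr fun e => ih _

/-- A function that the transition operator contracts tends to zero along almost every
trajectory. -/
lemma ae_tendsto_zero_of_transition_le {g : X → ℝ≥0∞} (hg : Measurable g) {r : ℝ≥0∞} (hr : r < 1)
    (hgr : ∀ x, transition κ φ g x ≤ r * g x) (x : X) (hx : g x ≠ ∞) :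
    ∀ᵐ ω ∂(iidLaw κ), Tendsto (fun n => g (forwardIter φ x ω n)) atTop (𝓝 0) := by
  have hle : ∀ n, ∫⁻ ω, g (forwardIter φ x ω n) ∂(iidLaw κ) ≤ r ^ n * g x := by
    intro n
    induction n with
    | zero => simp [forwardIter]
    | succ n ih =>
      rw [lintegral_forwardIter_succ hφ κ hg]
      calc _ ≤ ∫⁻ ω, r * g (forwardIter φ x ω n) ∂(iidLaw κ) := lintegral_mono fun ω => hgr _
        _ = r * ∫⁻ ω, g (forwardIter φ x ω n) ∂(iidLaw κ) :=
          lintegral_const_mul _ (measurable_comp_forwardIter hφ hg x n)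
        _ ≤ r * (r ^ n * g x) := by gcongr
        _ = _ := by ring
  -- Geometric decay of the means makes the whole series integrable, so it converges almost surely
  -- and its terms vanish.
  have hsum : ∫⁻ ω, ∑' n, g (forwardIter φ x ω n) ∂(iidLaw κ) ≠ ∞ := by
    rw [lintegral_tsum fun n => (measurable_comp_forwardIter hφ hg x n).aemeasurable]
    refine ne_top_of_le_ne_top ?_ (ENNReal.tsum_le_tsum hle)
    rw [ENNReal.tsum_mul_right, ENNReal.tsum_geometric]
    exact ENNReal.mul_ne_top (ENNReal.inv_ne_top.2 (tsub_pos_of_lt hr).ne') hx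
  filter_upwards [ae_lt_top' (AEMeasurable.tsum fun n =>
    (measurable_comp_forwardIter hφ hg x n).aemeasurable) hsum] with ω hω
  exact ENNReal.tendsto_atTop_zero_of_tsum_ne_top hω.ne

/-- Geometric drift bounds all moments of the Lyapunov function along the chain. -/
lemma transition_iterate_le_of_drift {V : X → ℝ≥0∞} (hV : Measurable V) {r C B : ℝ≥0∞}
    (hr : r ≤ 1) (hB : r * B + C ≤ B) (hdrift : ∀ x, transition κ φ V x ≤ r * V x + C)
    (x : X) (n : ℕ) : (transition κ φ)^[n] V x ≤ V x + B := by
  rw [← lintegral_forwardIter hφ κ hV]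
  induction n with
  | zero => simp [forwardIter]
  | succ n ih =>
    rw [lintegral_forwardIter_succ hφ κ hV]
    calc _ ≤ ∫⁻ ω, (r * V (forwardIter φ x ω n) + C) ∂(iidLaw κ) :=
          lintegral_mono fun ω => hdrift _
      _ = r * ∫⁻ ω, V (forwardIter φ x ω n) ∂(iidLaw κ) + C := by
        rw [lintegral_add_right _ measurable_const, lintegral_const_mul _
          (measurable_comp_forwardIter hφ hV x n)]
        simp
      _ ≤ r * (V x + B) + C := by gcongr
      _ = r * V x + (r * B + C) := by ring
      _ ≤ V x + B := by
        gcongr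
        exact mul_le_of_le_one_left (zero_le) hr

/-- Foster's criterion. -/
lemma tsum_transition_iterate_le {H c : X → ℝ≥0∞} (hH : Measurable H) (hc : Measurable c)
    (hdrift : ∀ x, transition κ φ H x + c x ≤ H x) (x : X) :
    ∑' n, (transition κ φ)^[n] c x ≤ H x := by
  rw [ENNReal.tsum_eq_iSup_nat]
  refine iSup_le fun n => ?_
  -- The remaining term in `H` is kept so that the induction telescopes.
  suffices h : (transition κ φ)^[n] H x + ∑ k ∈ Finset.range n, (transition κ φ)^[k] c x ≤ H x from
    le_trans le_add_self h
  induction n with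
  | zero => simp
  | succ n ih =>
    refine le_trans ?_ ih
    rw [Finset.sum_range_succ, ← add_assoc, add_right_comm]
    gcongr
    rw [← lintegral_forwardIter hφ κ hH, ← lintegral_forwardIter hφ κ hc,
      ← lintegral_forwardIter hφ κ hH, lintegral_forwardIter_succ hφ κ hH,
      ← lintegral_add_right _ (measurable_comp_forwardIter hφ hc x n)]
    exact lintegral_mono fun ω => hdrift _

end RandomIteration

/-! ### Coalescing trajectories and the invariant law -/

section Coalescence

variable {E X : Type*} {φ : E → X → X}

/-- The indicator function of the complement of the diagonal. -/
def offDiag (z : X × X) : ℝ≥0∞ := {z : X × X | z.1 ≠ z.2}.indicator 1 z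

lemma offDiag_of_ne {x y : X} (h : x ≠ y) : offDiag (x, y) = 1 := by simp [offDiag, h]

@[simp] lemma offDiag_self (x : X) : offDiag (x, x) = 0 := by simp [offDiag]

lemma offDiag_le_one (z : X × X) : offDiag z ≤ 1 := by
  rw [offDiag]
  exact indicator_le_self' (fun _ _ => zero_le) z

/-- The eventual value of an eventually constant sequence, and `x₀` for other sequences. -/
def eventualValue (x₀ : X) (u : ℕ → X) : X :=
  open Classical in if h : ∃ y, ∀ᶠ n in atTop, u n = y then h.choose else x₀

lemma eventualValue_eq (x₀ : X) {u : ℕ → X} {y : X} (h : ∀ᶠ n in atTop, u n = y) :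
    eventualValue x₀ u = y := by
  have h' : ∃ y, ∀ᶠ n in atTop, u n = y := ⟨y, h⟩
  rw [eventualValue, dif_pos h']
  obtain ⟨n, h1, h2⟩ := (h.and h'.choose_spec).exists
  exact h2.symm.trans h1

variable [MeasurableSpace E] [MeasurableSpace X] [MeasurableSingletonClass X]

lemma measurableSet_eventually_eq {f : ℕ → E → X}
    (hf : ∀ n, Measurable (f n)) (y : X) : MeasurableSet {ω | ∀ᶠ n in atTop, f n ω = y} := by
  simp only [eventually_atTop, ofPred_exists, ofPred_forall]
  exact MeasurableSet.iUnion fun a => MeasurableSet.iInter fun b => MeasurableSet.iInter fun _ =>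
    hf b (measurableSet_singleton y)

variable [Countable X]

lemma measurable_eventualValue (x₀ : X) {f : ℕ → E → X} (hf : ∀ n, Measurable (f n)) :
    Measurable fun ω => eventualValue x₀ fun n => f n ω := by
  refine measurable_to_countable' fun y => ?_
  have hS : MeasurableSet {ω | ∃ y, ∀ᶠ n in atTop, f n ω = y} := by
    rw [ofPred_exists]
    exact MeasurableSet.iUnion fun y => measurableSet_eventually_eq hf y
  have : (fun ω => eventualValue x₀ fun n => f n ω) ⁻¹' {y}
      = {ω | ∀ᶠ n in atTop, f n ω = y} ∪
        ({ω | ∃ y, ∀ᶠ n in atTop, f n ω = y}ᶜ ∩ {_ω | x₀ = y}) := by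
    ext ω
    simp only [mem_preimage, mem_singleton_iff, mem_union, mem_ofPred_eq, mem_inter_iff,
      mem_compl_iff]
    by_cases h : ∃ y, ∀ᶠ n in atTop, f n ω = y
    · obtain ⟨z, hz⟩ := h
      rw [eventualValue_eq x₀ hz]
      constructor
      · rintro rfl; exact Or.inl hz
      · rintro (h | h)
        · obtain ⟨n, h1, h2⟩ := (h.and hz).exists
          exact h2.symm.trans h1
        · exact absurd ⟨z, hz⟩ h.1
    · have : eventualValue x₀ (fun n => f n ω) = x₀ := by rw [eventualValue, dif_neg h]
      rw [this]
      constructor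
      · intro hy; exact Or.inr ⟨h, hy⟩
      · rintro (h' | h')
        · exact absurd ⟨y, h'⟩ h
        · exact h'.2
  rw [this]
  exact (measurableSet_eventually_eq hf y).union (hS.compl.inter (MeasurableSet.const _))

variable (hφ : Measurable (Function.uncurry φ)) (κ : Measure E) [IsProbabilityMeasure κ]
  {H : X × X → ℝ≥0∞}
  (hdrift : ∀ z, transition κ (coupledMap φ) H z + offDiag z ≤ H z)

include hφ hdrift

/-- Two trajectories with the same randomness coalesce almost surely. -/
lemma ae_eventually_forwardIter_eq (hH : ∀ z, H z ≠ ∞) (x y : X) :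
    ∀ᵐ ω ∂(iidLaw κ), ∀ᶠ n in atTop, forwardIter φ x ω n = forwardIter φ y ω n := by
  have hsum : ∑' n, iidLaw κ {ω | forwardIter φ x ω n ≠ forwardIter φ y ω n} ≠ ∞ := by
    refine ne_top_of_le_ne_top (hH (x, y)) (le_trans (ENNReal.tsum_le_tsum fun n => ?_)
      (tsum_transition_iterate_le (measurable_coupledMap hφ) κ Measurable.of_discrete
        Measurable.of_discrete hdrift (x, y)))
    rw [← lintegral_forwardIter (measurable_coupledMap hφ) κ Measurable.of_discrete,
      ← lintegral_indicator_one]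
    · exact (lintegral_congr fun ω => by rw [forwardIter_coupledMap]; rfl).le
    · exact (measurableSet_eq_fun (measurable_forwardIter hφ x n)
        (measurable_forwardIter hφ y n)).compl
  filter_upwards [ae_eventually_notMem hsum] with ω hω
  filter_upwards [hω] with n hn
  simpa using hn

/-- Backward iteration converges almost surely. -/
lemma ae_eventually_backwardIter_eq (x₀ : X) (hx₀ : ∫⁻ e, H (x₀, φ e x₀) ∂κ ≠ ∞) :
    ∀ᵐ ω ∂(iidLaw κ), ∃ y, ∀ᶠ n in atTop, backwardIter φ ω n x₀ = y := by
  have hmeas : ∀ n, Measurable fun ω => backwardIter φ ω n x₀ := fun n =>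
    (measurable_backwardIter hφ n).comp (f := fun ω => (ω, x₀)) (by fun_prop)
  -- This map sends `(x₀, x₀)` to `(x₀, φ e x₀)`. Backward iterates `n` and `n + 1` are the same
  -- `n`-fold composition applied to these two points, so they differ exactly when the coupled pair
  -- has not met.
  have hψ : Measurable (Function.uncurry fun (e : E) (z : X × X) => (z.1, φ e z.1)) :=
    measurable_snd.fst.prodMk (hφ.comp (measurable_fst.prodMk measurable_snd.fst))
  have hsum : ∑' n, iidLaw κ {ω | backwardIter φ ω n x₀ ≠ backwardIter φ ω (n + 1) x₀} ≠ ∞ := by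
    refine ne_top_of_le_ne_top hx₀ ?_
    calc _ = ∑' n, ∫⁻ e, (transition κ (coupledMap φ))^[n] offDiag (x₀, φ e x₀) ∂κ := by
          refine tsum_congr fun n => ?_
          have hS : MeasurableSet {ω | backwardIter φ ω n x₀ ≠ backwardIter φ ω (n + 1) x₀} :=
            (measurableSet_eq_fun (hmeas n) (hmeas (n + 1))).compl
          rw [← lintegral_indicator_one hS]
          have := lintegral_backwardIter_random (measurable_coupledMap hφ) κ hψ
            (g := offDiag) Measurable.of_discrete (x₀, x₀) n
          simp only [lintegral_backwardIter (measurable_coupledMap hφ) κ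
            (g := offDiag) Measurable.of_discrete] at this
          rw [← this]
          exact lintegral_congr fun ω => by rw [backwardIter_coupledMap]; rfl
      _ = ∫⁻ e, ∑' n, (transition κ (coupledMap φ))^[n] offDiag (x₀, φ e x₀) ∂κ := by
          rw [lintegral_tsum]
          intro n
          have h1 : Measurable fun e => (x₀, φ e x₀) :=
            measurable_const.prodMk (hφ.comp (f := fun e => (e, x₀)) (by fun_prop))
          have h2 : Measurable ((transition κ (coupledMap φ))^[n] offDiag) :=
            Measurable.of_discrete
          exact (h2.comp h1).aemeasurable
      _ ≤ ∫⁻ e, H (x₀, φ e x₀) ∂κ := lintegral_mono fun e =>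
          tsum_transition_iterate_le (measurable_coupledMap hφ) κ Measurable.of_discrete
            Measurable.of_discrete hdrift _
  filter_upwards [ae_eventually_notMem hsum] with ω hω
  obtain ⟨N, hN⟩ := eventually_atTop.1 hω
  refine ⟨backwardIter φ ω N x₀, eventually_atTop.2 ⟨N, fun n hn => ?_⟩⟩
  induction n, hn using Nat.le_induction with
  | base => rfl
  | succ n hn ih => rw [← ih]; simpa using (not_not.1 (hN n hn)).symm

/-- A random map whose trajectories coalesce has an invariant law, which is the limit in law of its
trajectories. -/
lemma exists_invariant_law (x₀ : X) (hx₀ : ∫⁻ e, H (x₀, φ e x₀) ∂κ ≠ ∞) :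
    ∃ ν : Measure X, IsProbabilityMeasure ν ∧
      (∀ n, ∀ A : Set X, ∫⁻ x, (transition κ φ)^[n] (A.indicator 1) x ∂ν = ν A) ∧
      ∀ (g : X → ℝ≥0∞) (C : ℝ≥0∞), (∀ n, (transition κ φ)^[n] g x₀ ≤ C) → ∫⁻ x, g x ∂ν ≤ C := by
  have hmeas : ∀ n, Measurable fun ω => backwardIter φ ω n x₀ := fun n =>
    (measurable_backwardIter hφ n).comp (f := fun ω => (ω, x₀)) (by fun_prop)
  set Y : (ℕ → E) → X := fun ω => eventualValue x₀ fun n => backwardIter φ ω n x₀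
  have hY : Measurable Y := measurable_eventualValue x₀ hmeas
  have hconv : ∀ᵐ ω ∂(iidLaw κ), ∀ᶠ n in atTop, backwardIter φ ω n x₀ = Y ω := by
    filter_upwards [ae_eventually_backwardIter_eq hφ κ hdrift x₀ hx₀] with ω ⟨y, hy⟩
    rwa [show Y ω = y from eventualValue_eq x₀ hy]
  have hlim : ∀ g : X → ℝ≥0∞, (∀ x, g x ≤ 1) →
      Tendsto (fun n => (transition κ φ)^[n] g x₀) atTop (𝓝 (∫⁻ x, g x ∂((iidLaw κ).map Y))) := by
    intro g hg
    rw [lintegral_map Measurable.of_discrete hY]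
    simp only [← lintegral_backwardIter hφ κ (Measurable.of_discrete (f := g))]
    refine tendsto_lintegral_of_dominated_convergence 1
      (fun n => (Measurable.of_discrete (f := g)).comp (hmeas n))
      (fun n => Eventually.of_forall fun ω => hg _) (by simp) ?_
    filter_upwards [hconv] with ω hω
    exact tendsto_const_nhds.congr' (hω.mono fun n hn => by simp only [hn])
  have hle : ∀ n (A : Set X) x, (transition κ φ)^[n] (A.indicator 1) x ≤ 1 := by
    intro n A x
    rw [← lintegral_forwardIter hφ κ Measurable.of_discrete]
    calc _ ≤ ∫⁻ ω, 1 ∂(iidLaw κ) := lintegral_mono fun ω =>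
          indicator_le_self' (f := 1) (fun _ _ => zero_le) (forwardIter φ x ω n)
      _ = 1 := by simp
  refine ⟨(iidLaw κ).map Y, Measure.isProbabilityMeasure_map hY.aemeasurable, fun n A => ?_,
    fun g C hC => ?_⟩
  -- Invariance: the limits for the test function `A.indicator 1` pushed `n` steps and for the time
  -- index shifted by `n` are limits of one sequence.
  · have h1 := hlim _ (hle n A)
    have h2 := (tendsto_add_atTop_iff_nat n).2 (hlim _ (hle 0 A))
    simp only [← Function.iterate_add_apply] at h1
    simp only [Function.iterate_zero, id] at h2
    rw [tendsto_nhds_unique h1 h2]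
    exact lintegral_indicator_one (Set.to_countable A).measurableSet
  · rw [lintegral_map Measurable.of_discrete hY]
    -- Here `g` may be unbounded, so Fatou replaces dominated convergence.
    calc ∫⁻ ω, g (Y ω) ∂(iidLaw κ)
        ≤ ∫⁻ ω, liminf (fun n => g (backwardIter φ ω n x₀)) atTop ∂(iidLaw κ) := by
          refine lintegral_mono_ae ?_
          filter_upwards [hconv] with ω hω
          exact (tendsto_const_nhds.congr' (hω.mono fun n hn => by simp only [hn])).liminf_eq.ge
      _ ≤ liminf (fun n => ∫⁻ ω, g (backwardIter φ ω n x₀) ∂(iidLaw κ)) atTop :=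
          lintegral_liminf_le fun n => (Measurable.of_discrete (f := g)).comp (hmeas n)
      _ ≤ C := by
          simp only [lintegral_backwardIter hφ κ (Measurable.of_discrete (f := g))]
          exact liminf_le_of_le (by isBoundedDefault) fun b hb =>
            (hb.exists).elim fun n hn => hn.trans (hC n)

end Coalescence

instance discreteMeasurableSpace_sum {α β : Type*} [MeasurableSpace α] [MeasurableSpace β]
    [DiscreteMeasurableSpace α] [DiscreteMeasurableSpace β] : DiscreteMeasurableSpace (α ⊕ β) :=
  ⟨fun _ => measurableSet_sum_iff.2 ⟨.of_discrete, .of_discrete⟩⟩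

instance discreteMeasurableSpace_clock (K m : ℕ) : DiscreteMeasurableSpace (Clock K m) :=
  discreteMeasurableSpace_sum

/-! ### Chains driven by independent components -/

section Product

variable {E₁ E₂ X₁ X₂ : Type*} [MeasurableSpace E₁] [MeasurableSpace E₂] [MeasurableSpace X₁]
  [MeasurableSpace X₂] {φ₁ : E₁ → X₁ → X₁} {φ₂ : E₂ → X₂ → X₂}

/-- The random map on a product that acts on the two coordinates through the two components of the
randomness. -/
def productMap (φ₁ : E₁ → X₁ → X₁) (φ₂ : E₂ → X₂ → X₂) (e : E₁ × E₂) (z : X₁ × X₂) : X₁ × X₂ :=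
  (φ₁ e.1 z.1, φ₂ e.2 z.2)

omit [MeasurableSpace E₁] [MeasurableSpace E₂] [MeasurableSpace X₁] [MeasurableSpace X₂] in
lemma forwardIter_productMap (x₁ : X₁) (x₂ : X₂) (ω : ℕ → E₁ × E₂) (n : ℕ) :
    forwardIter (productMap φ₁ φ₂) (x₁, x₂) ω n
      = (forwardIter (fun e => φ₁ e.1) x₁ ω n, forwardIter (fun e => φ₂ e.2) x₂ ω n) := by
  induction n with
  | zero => rfl
  | succ n ih => simp only [forwardIter, ih, productMap]

/-- Chains that are driven by independent sources of randomness are independent. -/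
lemma lintegral_mul_forwardIter (hφ₁ : Measurable (Function.uncurry φ₁))
    (hφ₂ : Measurable (Function.uncurry φ₂)) (κ₁ : Measure E₁) (κ₂ : Measure E₂)
    [IsProbabilityMeasure κ₁] [IsProbabilityMeasure κ₂] {a : X₁ → ℝ≥0∞} {b : X₂ → ℝ≥0∞}
    (ha : Measurable a) (hb : Measurable b) (x₁ : X₁) (x₂ : X₂) (n : ℕ) :
    ∫⁻ ω, a (forwardIter (fun e => φ₁ e.1) x₁ ω n) * b (forwardIter (fun e => φ₂ e.2) x₂ ω n)
        ∂(iidLaw (κ₁.prod κ₂))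
      = (transition κ₁ φ₁)^[n] a x₁ * (transition (κ₁.prod κ₂) (fun e => φ₂ e.2))^[n] b x₂ := by
  have hφ : Measurable (Function.uncurry (productMap φ₁ φ₂)) :=
    (hφ₁.comp (measurable_fst.fst.prodMk measurable_snd.fst)).prodMk
      (hφ₂.comp (measurable_fst.snd.prodMk measurable_snd.snd))
  have hψ : Measurable (Function.uncurry fun (e : E₁ × E₂) => φ₂ e.2) :=
    hφ₂.comp (measurable_fst.snd.prodMk measurable_snd)
  have key := lintegral_forwardIter hφ (κ₁.prod κ₂) (g := fun z => a z.1 * b z.2)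
    ((ha.comp measurable_fst).mul (hb.comp measurable_snd)) (x₁, x₂) n
  simp only [forwardIter_productMap] at key
  rw [key]
  clear key
  induction n generalizing a b with
  | zero => rfl
  | succ n ih =>
    rw [Function.iterate_succ_apply, Function.iterate_succ_apply, Function.iterate_succ_apply,
      ← ih (measurable_transition hφ₁ κ₁ ha) (measurable_transition hψ _ hb)]
    refine congrFun (congrArg _ (funext fun z => ?_)) _
    have h1 : Measurable fun e => a (φ₁ e z.1) :=
      ha.comp (hφ₁.comp (measurable_id.prodMk measurable_const))
    have h2 : Measurable fun e => b (φ₂ e z.2) :=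
      hb.comp (hφ₂.comp (measurable_id.prodMk measurable_const))
    simp only [transition, productMap]
    rw [lintegral_prod_mul h1.aemeasurable h2.aemeasurable,
      (measurePreserving_snd (μ := κ₁) (ν := κ₂)).lintegral_comp h2]

end Product

/-! ### Event times and measurability of the process -/

section Timing

variable {K m : ℕ}

/-- Time of the last of the first `n` events. -/
def arrivalTime (ω : ℕ → Mark K m) (n : ℕ) : ℝ := ∑ i ∈ Finset.range n, (ω i).1

lemma arrivalTime_eq_forwardIter (ω : ℕ → Mark K m) (n : ℕ) :
    arrivalTime ω n = forwardIter (fun (e : Mark K m) s => s + e.1) (0 : ℝ) ω n := by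
  induction n with
  | zero => simp [arrivalTime, forwardIter]
  | succ n ih => rw [arrivalTime, Finset.sum_range_succ, forwardIter, ← ih, arrivalTime]

lemma measurable_arrivalTime (n : ℕ) : Measurable fun ω : ℕ → Mark K m => arrivalTime ω n :=
  Finset.measurable_fun_sum _ fun i _ => (measurable_pi_apply i).fst

/-- The times between events are positive and the events do not accumulate. -/
def IsRegular (ω : ℕ → Mark K m) : Prop :=
  (∀ n, 0 < (ω n).1) ∧ Tendsto (arrivalTime ω) atTop atTop

lemma IsRegular.strictMono {ω : ℕ → Mark K m} (h : IsRegular ω) : StrictMono (arrivalTime ω) :=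
  strictMono_nat_of_lt_succ fun n => by
    rw [arrivalTime, arrivalTime, Finset.sum_range_succ]; linarith [h.1 n]

lemma IsRegular.exists_mem {ω : ℕ → Mark K m} (h : IsRegular ω) {t : ℝ} (ht : 0 ≤ t) :
    ∃ n, arrivalTime ω n ≤ t ∧ t < arrivalTime ω (n + 1) := by
  obtain ⟨N, hN⟩ := (h.2.eventually_gt_atTop t).exists
  classical
  have hex : ∃ n, t < arrivalTime ω n := ⟨N, hN⟩
  have h0 : Nat.find hex ≠ 0 := fun h0 => by
    have := Nat.find_spec hex
    rw [h0] at this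
    simp only [arrivalTime, Finset.range_zero, Finset.sum_empty] at this
    linarith
  obtain ⟨n, hn⟩ := Nat.exists_eq_succ_of_ne_zero h0
  exact ⟨n, not_lt.1 (Nat.find_min hex (by omega)), by
    have := Nat.find_spec hex; rwa [hn] at this⟩

lemma IsRegular.eventTime_le_iff {ω : ℕ → Mark K m} (h : IsRegular ω) {t : ℝ} {n : ℕ}
    (h1 : arrivalTime ω n ≤ t) (h2 : t < arrivalTime ω (n + 1)) (k : ℕ) :
    arrivalTime ω (k + 1) ≤ t ↔ k < n := by
  constructor
  · intro hk
    have := h.strictMono.lt_iff_lt.1 (hk.trans_lt h2)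
    omega
  · intro hk
    exact (h.strictMono.monotone (by omega)).trans h1

lemma IsRegular.eventCount_eq {ω : ℕ → Mark K m} (h : IsRegular ω) {t : ℝ} {n : ℕ}
    (h1 : arrivalTime ω n ≤ t) (h2 : t < arrivalTime ω (n + 1)) : eventCount ω t = n := by
  have : {k | eventTime ω k ≤ t} = ((Finset.range n : Finset ℕ) : Set ℕ) := by
    ext k
    rw [mem_ofPred_eq, Finset.mem_coe, Finset.mem_range]
    exact h.eventTime_le_iff h1 h2 k
  rw [eventCount, this, Set.ncard_coe_finset, Finset.card_range]

lemma IsRegular.tendsto_eventCount {ω : ℕ → Mark K m} (h : IsRegular ω) :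
    Tendsto (eventCount ω) atTop atTop := by
  refine tendsto_atTop.2 fun n => ?_
  filter_upwards [eventually_ge_atTop (arrivalTime ω n), eventually_ge_atTop 0] with t ht ht0
  obtain ⟨j, h1, h2⟩ := h.exists_mem ht0
  rw [h.eventCount_eq h1 h2]
  have := h.strictMono.lt_iff_lt.1 (ht.trans_lt h2)
  omega

lemma Policy.measurable_chain (p : Policy K m) (x₀ : State K) (n : ℕ) :
    Measurable fun ω => p.chain x₀ ω n := by
  induction n with
  | zero => exact measurable_const
  | succ n ih =>
    have h : Measurable fun z : Bool × Clock K m × State K => step z.1 z.2.1 z.2.2 :=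
      .of_discrete
    have ha : Measurable fun ω => p.action ω n (p.chain x₀ ω n) := by
      refine (p.measurable_act n).comp (f := fun ω : ℕ → Mark K m =>
        (fun i : Fin n => ω i, (ω n).1, (p.chain x₀ ω n).1, (p.chain x₀ ω n).2, (ω n).2.2)) ?_
      refine Measurable.prodMk ?_ ?_
      · exact measurable_pi_iff.2 fun i => measurable_pi_apply _
      · exact (measurable_pi_apply n).fst.prodMk (ih.fst.prodMk
          (ih.snd.prodMk (measurable_pi_apply n).snd.snd))
    exact h.comp (ha.prodMk ((measurable_pi_apply n).snd.fst.prodMk ih))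

namespace HybridSystem

variable (M : HybridSystem K m)

/-- Law of one event. -/
def markLaw : Measure (Mark K m) :=
  (expMeasure M.totalRate).prod (M.clockLaw.prod M.scoreLaw)

instance : IsProbabilityMeasure M.markLaw := by unfold markLaw; infer_instance

lemma prob_eq : M.prob = iidLaw M.markLaw := rfl

instance : IsProbabilityMeasure M.prob := by unfold prob; infer_instance

lemma ae_expMeasure_pos {r : ℝ} (hr : 0 < r) : ∀ᵐ x ∂(expMeasure r), 0 < x := by
  have := isProbabilityMeasure_expMeasure hr
  have h : expMeasure r (Iic 0) = 0 := by
    rw [← ofReal_cdf, cdf_expMeasure_eq hr]; simp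
  rw [ae_iff]
  exact measure_mono_null (fun x hx => not_lt.1 hx) h

lemma lintegral_exp_neg_lt_one {r : ℝ} (hr : 0 < r) :
    ∫⁻ x, ENNReal.ofReal (Real.exp (-x)) ∂(expMeasure r) < 1 := by
  have := isProbabilityMeasure_expMeasure hr
  have hle : ∀ᵐ x ∂(expMeasure r), ENNReal.ofReal (Real.exp (-x)) < 1 := by
    filter_upwards [ae_expMeasure_pos hr] with x hx
    rw [ENNReal.ofReal_lt_one, Real.exp_lt_one_iff]
    linarith
  have h1 : ∫⁻ _x, (1 : ℝ≥0∞) ∂(expMeasure r) = 1 := by simp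
  calc _ < ∫⁻ _x, (1 : ℝ≥0∞) ∂(expMeasure r) := by
        refine lintegral_strict_mono (IsProbabilityMeasure.ne_zero _) aemeasurable_const ?_ hle
        exact ((lintegral_mono_ae (hle.mono fun x hx => hx.le)).trans_lt
          (h1.trans_lt ENNReal.one_lt_top)).ne
    _ = 1 := h1

/-- One step multiplies the mean of `exp (-s)` at event time `s` by the Laplace transform of the
gap, which is below one. So `exp (-s)` tends to zero along the events, that is, they do not
accumulate. -/
lemma ae_isRegular : ∀ᵐ ω ∂M.prob, IsRegular ω := by
  have hpos : ∀ᵐ ω ∂M.prob, ∀ n, 0 < (ω n).1 := by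
    refine ae_all_iff.2 fun n => ?_
    have h1 : MeasurePreserving (fun ω : ℕ → Mark K m => ω n) M.prob M.markLaw :=
      measurePreserving_eval_infinitePi (fun _ => M.markLaw) n
    have h2 : MeasurePreserving (fun ω : ℕ → Mark K m => (ω n).1) M.prob
        (expMeasure M.totalRate) := measurePreserving_fst.comp h1
    exact h2.quasiMeasurePreserving.ae (ae_expMeasure_pos M.totalRate_pos)
  have hφ : Measurable (Function.uncurry fun (e : Mark K m) (s : ℝ) => s + e.1) := by
    fun_prop
  have hg : Measurable fun s : ℝ => ENNReal.ofReal (Real.exp (-s)) := by fun_prop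
  have hlim := ae_tendsto_zero_of_transition_le hφ M.markLaw hg
    (lintegral_exp_neg_lt_one M.totalRate_pos) (fun s => by
      have hm : Measurable fun x : ℝ => ENNReal.ofReal (Real.exp (-(s + x))) := by fun_prop
      rw [transition, markLaw, measurePreserving_fst.lintegral_comp hm,
        mul_comm, ← lintegral_const_mul _ hg]
      refine (lintegral_congr fun x => ?_).le
      rw [← ENNReal.ofReal_mul (Real.exp_nonneg _), ← Real.exp_add, neg_add]) 0 (by simp)
  filter_upwards [hpos, hlim] with ω h1 h2
  refine ⟨h1, ?_⟩
  simp only [← arrivalTime_eq_forwardIter] at h2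
  have h3 := (ENNReal.tendsto_toReal ENNReal.zero_ne_top).comp h2
  simp only [Function.comp_def, ENNReal.toReal_ofReal (Real.exp_nonneg _), ENNReal.toReal_zero,
    Real.tendsto_exp_comp_nhds_zero, tendsto_neg_atBot_iff] at h3
  exact h3

/-- Partial counts over the first `k` events are measurable, and on regular trajectories they are
eventually equal to the full count. -/
lemma aemeasurable_eventCount {t : ℝ} (ht : 0 ≤ t) :
    AEMeasurable (fun ω : ℕ → Mark K m => eventCount ω t) M.prob := by
  refine ⟨fun ω => eventualValue 0 fun k =>
    ∑ j ∈ Finset.range k, {ω : ℕ → Mark K m | arrivalTime ω (j + 1) ≤ t}.indicator 1 ω, ?_, ?_⟩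
  · refine measurable_eventualValue 0 fun k => Finset.measurable_fun_sum _ fun j _ => ?_
    exact measurable_one.indicator (measurableSet_le (measurable_arrivalTime _) measurable_const)
  · filter_upwards [M.ae_isRegular] with ω hω
    obtain ⟨n, h1, h2⟩ := hω.exists_mem ht
    rw [hω.eventCount_eq h1 h2]
    refine (eventualValue_eq 0 (eventually_atTop.2 ⟨n, fun k hk => ?_⟩)).symm
    classical
    simp only [indicator_apply, mem_ofPred_eq, hω.eventTime_le_iff h1 h2, Pi.one_apply,
      Finset.sum_boole, Nat.cast_id]
    have : (Finset.range k).filter (· < n) = Finset.range n := by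
      ext j; simp only [Finset.mem_filter, Finset.mem_range]; omega
    rw [this, Finset.card_range]

lemma aemeasurable_process (p : Policy K m) (x₀ : State K) {t : ℝ} (ht : 0 ≤ t) :
    AEMeasurable (p.process x₀ t) M.prob := by
  have h : Measurable fun z : ℕ × (ℕ → Mark K m) => p.chain x₀ z.2 z.1 :=
    measurable_from_prod_countable_right fun n => p.measurable_chain x₀ n
  exact h.comp_aemeasurable ((M.aemeasurable_eventCount ht).prodMk aemeasurable_id)

lemma isProbabilityMeasure_law (p : Policy K m) (x₀ : State K) {t : ℝ} (ht : 0 ≤ t) :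
    IsProbabilityMeasure (M.law p t x₀) :=
  Measure.isProbabilityMeasure_map (M.aemeasurable_process p x₀ ht)

end HybridSystem

end Timing

/-- Dominated convergence for indicators. A general countably generated filter is needed because
time is continuous, and null measurability because the process is only almost everywhere measurable.
-/
lemma tendsto_measure_zero_of_ae_eventually_notMem {Ω ι : Type*} [MeasurableSpace Ω]
    {μ : Measure Ω} [IsFiniteMeasure μ] {l : Filter ι} [l.IsCountablyGenerated] {A : ι → Set Ω}
    (hA : ∀ᶠ i in l, NullMeasurableSet (A i) μ) (h : ∀ᵐ ω ∂μ, ∀ᶠ i in l, ω ∉ A i) :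
    Tendsto (fun i => μ (A i)) l (𝓝 0) := by
  have key : Tendsto (fun i => ∫ ω, (A i).indicator (1 : Ω → ℝ) ω ∂μ) l (𝓝 (∫ _ω, (0 : ℝ) ∂μ)) := by
    refine tendsto_integral_filter_of_dominated_convergence (fun _ => 1) ?_ ?_
      (integrable_const _) ?_
    · exact hA.mono fun i hi => aestronglyMeasurable_one.indicator₀ hi
    · exact Eventually.of_forall fun i => Eventually.of_forall fun ω =>
        (norm_indicator_le_norm_self _ _).trans (by simp)
    · filter_upwards [h] with ω hω
      exact tendsto_const_nhds.congr' (hω.mono fun i hi => by simp [hi])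
  rw [integral_zero] at key
  have := ENNReal.tendsto_ofReal key
  rw [ENNReal.ofReal_zero] at this
  refine this.congr' (hA.mono fun i hi => ?_)
  rw [integral_indicator₀ hi]
  simp [Measure.real]

/-! ### Stationary policies: from the embedded chain to continuous time -/

variable {K m : ℕ}

/-- The random map of a stationary policy: the randomness is the clock that rings and the score. -/
def StationaryPolicy.map (p : StationaryPolicy K) (e : Clock K m × ℝ) (x : State K) : State K :=
  step (p.act x.1 x.2 e.2) e.1 x

lemma StationaryPolicy.measurable_map (p : StationaryPolicy K) :
    Measurable (Function.uncurry (p.map (m := m))) := by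
  have hx : ∀ x : State K, Measurable fun e : Clock K m × ℝ => p.map e x := by
    intro x
    have h : Measurable fun z : Bool × Clock K m => step z.1 z.2 x := .of_discrete
    exact h.comp (((p.measurable_act x.1 x.2).comp measurable_snd).prodMk measurable_fst)
  have h : Measurable fun z : State K × (Clock K m × ℝ) => p.map z.2 z.1 :=
    measurable_from_prod_countable_right hx
  exact h.comp measurable_swap

lemma StationaryPolicy.measurable_markMap (p : StationaryPolicy K) :
    Measurable (Function.uncurry fun e : Mark K m => p.map e.2) :=
  p.measurable_map.comp (measurable_fst.snd.prodMk measurable_snd)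

lemma StationaryPolicy.chain_eq (p : StationaryPolicy K) (x : State K) (ω : ℕ → Mark K m) (n : ℕ) :
    (p.toPolicy m).chain x ω n = forwardIter (fun e => p.map e.2) x ω n := by
  induction n with
  | zero => rfl
  | succ n ih => simp only [Policy.chain, forwardIter, ih]; rfl

namespace HybridSystem

variable (M : HybridSystem K m)

/-- The transition operator of the embedded chain of a stationary policy. -/
def kernel (p : StationaryPolicy K) : (State K → ℝ≥0∞) → State K → ℝ≥0∞ :=
  transition M.markLaw fun e => p.map e.2

lemma lintegral_law (p : Policy K m) (x : State K) {t : ℝ} (ht : 0 ≤ t) (g : State K → ℝ≥0∞) :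
    ∫⁻ y, g y ∂(M.law p t x) = ∫⁻ ω, g (p.process x t ω) ∂M.prob :=
  lintegral_map' Measurable.of_discrete.aemeasurable (M.aemeasurable_process p x ht)

/-- Since the times of the events are independent of the embedded chain, the law at time `t` is a
mixture of the laws of the embedded chain. -/
lemma exists_mixture {t : ℝ} (ht : 0 ≤ t) :
    ∃ u : ℕ → ℝ≥0∞, ∑' n, u n = 1 ∧ ∀ (p : StationaryPolicy K) (g : State K → ℝ≥0∞) (x : State K),
      ∫⁻ y, g y ∂(M.law (p.toPolicy m) t x) = ∑' n, u n * (M.kernel p)^[n] g x := by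
  have hT : Measurable (Function.uncurry fun (e : ℝ) (s : ℝ) => s + e) := by fun_prop
  -- `a s` is the probability that an event time `s` is at most `t` and the next event comes after
  -- `t`. Hence `u n` below is the probability of exactly `n` events up to time `t`.
  set a : ℝ → ℝ≥0∞ := fun s => M.markLaw {e | s ≤ t ∧ t < s + e.1}
  have hset : MeasurableSet {z : ℝ × Mark K m | z.1 ≤ t ∧ t < z.1 + z.2.1} :=
    (measurableSet_le measurable_fst measurable_const).inter
      (measurableSet_lt measurable_const (measurable_fst.add measurable_snd.fst))
  have ha : Measurable a := measurable_measure_prodMk_left hset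
  set u : ℕ → ℝ≥0∞ := fun n => (transition (expMeasure M.totalRate) fun e s => s + e)^[n] a 0
  have hmix : ∀ (p : StationaryPolicy K) (g : State K → ℝ≥0∞) (x : State K),
      ∫⁻ y, g y ∂(M.law (p.toPolicy m) t x) = ∑' n, u n * (M.kernel p)^[n] g x := by
    intro p g x
    set X : (ℕ → Mark K m) → ℕ → State K := forwardIter (fun e => p.map e.2) x
    have hX : ∀ n, Measurable fun ω => X ω n := measurable_forwardIter p.measurable_markMap x
    -- The mark `e` of event `n` is separated from `ω`: everything else in `F` depends only on the
    -- earlier events, so `e` can be integrated out.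
    set F : ℕ → Mark K m → (ℕ → Mark K m) → ℝ≥0∞ := fun n e ω =>
      {z : ℝ × Mark K m | z.1 ≤ t ∧ t < z.1 + z.2.1}.indicator 1 (arrivalTime ω n, e)
        * g (X ω n)
    have hF : ∀ n, Measurable (Function.uncurry (F n)) := by
      intro n
      refine Measurable.mul ?_ ?_
      · exact (measurable_one.indicator hset).comp
          (((measurable_arrivalTime n).comp measurable_snd).prodMk measurable_fst)
      · exact (Measurable.of_discrete (f := g)).comp ((hX n).comp measurable_snd)
    have hsucc : ∀ (ω : ℕ → Mark K m) n, arrivalTime ω (n + 1) = arrivalTime ω n + (ω n).1 :=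
      fun ω n => Finset.sum_range_succ _ _
    rw [M.lintegral_law _ _ ht]
    have h1 : ∀ᵐ ω ∂M.prob, g ((p.toPolicy m).process x t ω) = ∑' n, F n (ω n) ω := by
      filter_upwards [M.ae_isRegular] with ω hω
      obtain ⟨n, h1, h2⟩ := hω.exists_mem ht
      rw [tsum_eq_single n]
      · rw [Policy.process, hω.eventCount_eq h1 h2, p.chain_eq]
        have : (arrivalTime ω n, ω n) ∈ {z : ℝ × Mark K m | z.1 ≤ t ∧ t < z.1 + z.2.1} :=
          ⟨h1, by rw [← hsucc]; exact h2⟩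
        simp only [F, indicator_of_mem this, Pi.one_apply, one_mul]
        rfl
      · intro k hk
        have : (arrivalTime ω k, ω k) ∉ {z : ℝ × Mark K m | z.1 ≤ t ∧ t < z.1 + z.2.1} := by
          rintro ⟨h3, h4⟩
          rw [← hsucc] at h4
          exact hk ((hω.eventCount_eq h3 h4).symm.trans (hω.eventCount_eq h1 h2))
        simp only [F, indicator_of_notMem this, zero_mul]
    have hF' : ∀ n, Measurable fun ω => F n (ω n) ω := by
      intro n
      have h : Measurable fun ω : ℕ → Mark K m => (ω n, ω) :=
        (measurable_pi_apply n).prodMk measurable_id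
      exact (hF n).comp h
    rw [lintegral_congr_ae h1, lintegral_tsum fun n => (hF' n).aemeasurable]
    refine tsum_congr fun n => ?_
    rw [prob_eq, lintegral_coordinate M.markLaw n (F n) (hF n), lintegral_lintegral_swap
      (hF n).aemeasurable]
    · have h2 : ∀ ω : ℕ → Mark K m, ∫⁻ e, F n e ω ∂M.markLaw
          = a (forwardIter (fun (e : Mark K m) s => s + e.1) (0 : ℝ) ω n)
            * g (forwardIter (fun e : Mark K m => p.map e.2) x ω n) := by
        intro ω
        have hm : MeasurableSet {e : Mark K m | arrivalTime ω n ≤ t ∧ t < arrivalTime ω n + e.1} :=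
          measurable_prodMk_left hset
        have hm' : Measurable fun e : Mark K m => {z : ℝ × Mark K m | z.1 ≤ t ∧
            t < z.1 + z.2.1}.indicator (1 : ℝ × Mark K m → ℝ≥0∞) (arrivalTime ω n, e) :=
          (measurable_one.indicator hset).comp measurable_prodMk_left
        rw [← arrivalTime_eq_forwardIter]
        refine (lintegral_mul_const _ hm').trans ?_
        congr 1
        exact lintegral_indicator_one hm
      simp only [h2]
      exact lintegral_mul_forwardIter hT p.measurable_map _ _ ha Measurable.of_discrete 0 x n
    · intro e e' ω
      have h3 : arrivalTime (Function.update ω n e') n = arrivalTime ω n :=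
        Finset.sum_congr rfl fun i hi => by
          rw [Function.update_of_ne (Finset.mem_range.1 hi).ne]
      have h4 : X (Function.update ω n e') n = X ω n :=
        forwardIter_congr x n fun i hi => Function.update_of_ne hi.ne _ _
      simp only [F, h3, h4]
  refine ⟨u, ?_, hmix⟩
  -- The weights do not depend on the policy, so any policy and `g = 1` give their total mass.
  let p : StationaryPolicy K := ⟨fun _ _ _ => true, fun _ _ => measurable_const⟩
  have h1 := hmix p 1 (0, ⟨0, M.states_pos⟩)
  have h2 : ∀ n, (M.kernel p)^[n] 1 = 1 := by
    intro n
    induction n with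
    | zero => rfl
    | succ n ih =>
      rw [Function.iterate_succ_apply', ih]
      funext x
      simp [kernel, transition]
  have := M.isProbabilityMeasure_law (p.toPolicy m) (0, ⟨0, M.states_pos⟩) ht
  simp only [h2, Pi.one_apply, mul_one, lintegral_const, measure_univ] at h1
  exact h1.symm

/-- A stationary policy has a finite mean queue if its embedded chain satisfies a geometric drift
condition and two of its trajectories with the same randomness meet within a finite mean time. -/
theorem hasFiniteMeanQueue_of_drift (p : StationaryPolicy K) {V : State K → ℝ≥0∞}
    (hV : ∀ x, V x ≠ ∞) (hqV : ∀ x : State K, (x.1 : ℝ≥0∞) ≤ V x) {r C : ℝ≥0∞} (hr : r < 1)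
    (hC : C ≠ ∞) (hdrift : ∀ x, M.kernel p V x ≤ r * V x + C) {H : State K × State K → ℝ≥0∞}
    (hH : ∀ z, H z ≠ ∞)
    (hcouple : ∀ z, transition M.markLaw (coupledMap fun e => p.map e.2) H z + offDiag z ≤ H z)
    (x₀ : State K) (hx₀ : ∫⁻ e, H (x₀, p.map e.2 x₀) ∂M.markLaw ≠ ∞) :
    M.HasFiniteMeanQueue p := by
  have hφ := p.measurable_markMap (m := m)
  have hr' : r ≤ 1 := hr.le
  -- The fixed point of `B ↦ r * B + C`.
  set B : ℝ≥0∞ := C / (1 - r)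
  have hr0 : 1 - r ≠ 0 := (tsub_pos_of_lt hr).ne'
  have hBtop : B ≠ ∞ := ENNReal.div_ne_top hC hr0
  have hB : r * B + C ≤ B := by
    have h1 : (1 - r) * B = C := ENNReal.mul_div_cancel hr0 (by finiteness)
    calc r * B + C = r * B + (1 - r) * B := by rw [h1]
      _ = (r + (1 - r)) * B := by ring
      _ = B := by rw [add_tsub_cancel_of_le hr', one_mul]
      _ ≤ B := le_rfl
  have hbound : ∀ x n, (M.kernel p)^[n] (fun y => (y.1 : ℝ≥0∞)) x ≤ V x + B := by
    intro x n
    refine le_trans ?_ (transition_iterate_le_of_drift hφ M.markLaw .of_discrete hr' hB hdrift x n)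
    rw [kernel, ← lintegral_forwardIter hφ _ .of_discrete,
      ← lintegral_forwardIter hφ _ .of_discrete]
    exact lintegral_mono fun ω => hqV _
  have hmean : ∀ (x : State K) (t : ℝ), 0 ≤ t →
      ∫⁻ y, (y.1 : ℝ≥0∞) ∂(M.law (p.toPolicy m) t x) ≤ V x + B := by
    intro x t ht
    obtain ⟨u, hu, hmix⟩ := M.exists_mixture ht
    rw [hmix]
    calc _ ≤ ∑' n, u n * (V x + B) := ENNReal.tsum_le_tsum fun n => by gcongr; exact hbound x n
      _ = V x + B := by rw [ENNReal.tsum_mul_right, hu, one_mul]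
  have hlt : ∀ x, V x + B < ∞ := fun x => ENNReal.add_lt_top.2 ⟨(hV x).lt_top, hBtop.lt_top⟩
  refine ⟨?_, fun x => ⟨V x + B, hlt x, hmean x⟩⟩
  obtain ⟨ν, hν, hinv, hlim⟩ := exists_invariant_law hφ M.markLaw hcouple x₀ hx₀
  have hstat : M.IsStationaryLaw p ν := by
    refine ⟨hν, fun t ht => ?_⟩
    obtain ⟨u, hu, hmix⟩ := M.exists_mixture ht
    ext A hA
    rw [Measure.bind_apply hA Measurable.of_discrete.aemeasurable]
    simp only [← lintegral_indicator_one hA, hmix]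
    rw [lintegral_tsum fun n => Measurable.of_discrete.aemeasurable]
    simp only [lintegral_const_mul _ Measurable.of_discrete, kernel, hinv, ENNReal.tsum_mul_right,
      hu, one_mul, lintegral_indicator_one hA]
  refine ⟨ν, hstat, ?_, (hlim _ _ (hbound x₀)).trans_lt (hlt x₀)⟩
  set D : ℝ → State K × State K → ℝ≥0∞ := fun t z =>
    M.prob {ω | (p.toPolicy m).process z.1 t ω ≠ (p.toPolicy m).process z.2 t ω}
  have hDle : ∀ t z, D t z ≤ 1 := fun t z => prob_le_one
  have hDlim : ∀ z, Tendsto (fun t => D t z) atTop (𝓝 0) := by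
    intro z
    have hnull : ∀ t, 0 ≤ t → NullMeasurableSet
        {ω | (p.toPolicy m).process z.1 t ω ≠ (p.toPolicy m).process z.2 t ω} M.prob := fun t ht =>
      (nullMeasurableSet_eq_fun (M.aemeasurable_process _ _ ht)
        (M.aemeasurable_process _ _ ht)).compl
    have hev : ∀ᵐ ω ∂M.prob, ∀ᶠ t in atTop,
        (p.toPolicy m).process z.1 t ω = (p.toPolicy m).process z.2 t ω := by
      filter_upwards [M.ae_isRegular, ae_eventually_forwardIter_eq hφ M.markLaw hcouple hH z.1 z.2]
        with ω hω hev
      filter_upwards [hω.tendsto_eventCount.eventually hev] with t ht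
      rw [Policy.process, Policy.process, p.chain_eq, p.chain_eq, ht]
    refine tendsto_measure_zero_of_ae_eventually_notMem ?_ ?_
    · exact (eventually_ge_atTop 0).mono hnull
    · filter_upwards [hev] with ω hω
      exact hω.mono fun t ht => not_not.2 ht
  have hcomp : ∀ t, 0 ≤ t → ∀ x y (A : Set (State K)), M.law (p.toPolicy m) t x A
      ≤ M.law (p.toPolicy m) t y A + D t (x, y) := by
    intro t ht x y A
    rw [law, law, Measure.map_apply_of_aemeasurable (M.aemeasurable_process _ _ ht) .of_discrete,
      Measure.map_apply_of_aemeasurable (M.aemeasurable_process _ _ ht) .of_discrete]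
    refine (measure_mono fun ω hω => ?_).trans (measure_union_le _ _)
    by_cases h : (p.toPolicy m).process x t ω = (p.toPolicy m).process y t ω
    · left; rw [mem_preimage, ← h]; exact hω
    · right; exact h
  have hle : ∀ ν₁ ν₂, M.IsStationaryLaw p ν₁ → M.IsStationaryLaw p ν₂ →
      ∀ A : Set (State K), ν₁ A ≤ ν₂ A := by
    intro ν₁ ν₂ h₁ h₂ A
    have := h₁.1
    have := h₂.1
    -- Initial states are drawn independently from the two stationary laws and then driven by the
    -- same events. The laws at time `t` differ by at most the probability that the trajectories are
    -- still apart, which vanishes as `t → ∞`.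
    have key : ∀ t, 0 ≤ t → ν₁ A ≤ ν₂ A + ∫⁻ z, D t z ∂(ν₁.prod ν₂) := by
      intro t ht
      have e₁ : ∫⁻ z, M.law (p.toPolicy m) t z.1 A ∂(ν₁.prod ν₂) = ν₁ A := by
        rw [(measurePreserving_fst (μ := ν₁) (ν := ν₂)).lintegral_comp
          (f := fun x => M.law (p.toPolicy m) t x A) .of_discrete,
          ← Measure.bind_apply .of_discrete Measurable.of_discrete.aemeasurable, h₁.2 t ht]
      have e₂ : ∫⁻ z, M.law (p.toPolicy m) t z.2 A ∂(ν₁.prod ν₂) = ν₂ A := by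
        rw [(measurePreserving_snd (μ := ν₁) (ν := ν₂)).lintegral_comp
          (f := fun x => M.law (p.toPolicy m) t x A) .of_discrete,
          ← Measure.bind_apply .of_discrete Measurable.of_discrete.aemeasurable, h₂.2 t ht]
      rw [← e₁, ← e₂, ← lintegral_add_left .of_discrete]
      exact lintegral_mono fun z => hcomp t ht z.1 z.2 A
    have hlim0 : Tendsto (fun t => ∫⁻ z, D t z ∂(ν₁.prod ν₂)) atTop (𝓝 0) := by
      have := tendsto_lintegral_filter_of_dominated_convergence (μ := ν₁.prod ν₂) (l := atTop)
        (F := D) (f := fun _ => 0) (fun _ => 1)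
        (Eventually.of_forall fun t => Measurable.of_discrete)
        (Eventually.of_forall fun t => Eventually.of_forall fun z => hDle t z) (by simp)
        (Eventually.of_forall hDlim)
      simpa using this
    have := hlim0.const_add (ν₂ A)
    rw [add_zero] at this
    exact ge_of_tendsto this ((eventually_ge_atTop 0).mono key)
  intro ν' hν'
  ext A _
  exact le_antisymm (hle _ _ hν' hstat A) (hle _ _ hstat hν' A)

end HybridSystem

/-! ### Exponential moments and the Poisson equation of the drift -/

/-- A bounded family of random variables with uniformly negative mean has an exponential moment that
is uniformly less than one. -/
lemma exists_lintegral_exp_le {E ι : Type*} [MeasurableSpace E] (κ : Measure E)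
    [IsProbabilityMeasure κ] {ξ : ι → E → ℝ} (hξ : ∀ i, Measurable (ξ i)) {B : ℝ}
    (hB : ∀ i e, |ξ i e| ≤ B) {δ : ℝ} (hδ : 0 < δ) (hmean : ∀ i, ∫ e, ξ i e ∂κ ≤ -δ) :
    ∃ η > 0, ∃ ρ : ℝ≥0∞, ρ < 1 ∧ ∀ i, ∫⁻ e, ENNReal.ofReal (Real.exp (η * ξ i e)) ∂κ ≤ ρ := by
  -- With `b` at least `1` and `δ`, the choice of `η` keeps `η * ξ` in `[-1, 1]` and makes the
  -- quadratic error of the exponential at most half of the linear gain `η * δ`.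
  set b : ℝ := max B (max 1 δ)
  have hb1 : 1 ≤ b := (le_max_left _ _).trans (le_max_right _ _)
  have hbδ : δ ≤ b := (le_max_right _ _).trans (le_max_right _ _)
  have hb : ∀ i e, |ξ i e| ≤ b := fun i e => (hB i e).trans (le_max_left _ _)
  set η : ℝ := δ / (2 * b ^ 2)
  have hη : 0 < η := by positivity
  have hηb2 : η * b ^ 2 = δ / 2 := by simp only [η]; field_simp
  have hηb : η * b ≤ 1 := by
    have : η * b * b ≤ 1 * b := by nlinarith
    exact le_of_mul_le_mul_right this (by linarith)
  refine ⟨η, hη, ENNReal.ofReal (1 - η * δ / 2), ?_, fun i => ?_⟩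
  · rw [ENNReal.ofReal_lt_one]
    have := mul_pos hη hδ
    linarith
  have hpt : ∀ e, Real.exp (η * ξ i e) ≤ 1 + η * ξ i e + η * δ / 2 := by
    intro e
    have h1 : |η * ξ i e| ≤ 1 := by
      rw [abs_mul, abs_of_pos hη]
      exact (mul_le_mul_of_nonneg_left (hb i e) hη.le).trans hηb
    have h2 := (abs_le.1 (Real.abs_exp_sub_one_sub_id_le h1)).2
    have h3 : (ξ i e) ^ 2 ≤ b ^ 2 := sq_le_sq' (abs_le.1 (hb i e)).1 (abs_le.1 (hb i e)).2
    have h4 : (η * ξ i e) ^ 2 ≤ η * δ / 2 := by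
      calc (η * ξ i e) ^ 2 = η * (η * (ξ i e) ^ 2) := by ring
        _ ≤ η * (η * b ^ 2) := by gcongr
        _ = η * δ / 2 := by rw [hηb2]; ring
    linarith
  have hint : Integrable (ξ i) κ :=
    Integrable.of_bound (hξ i).aestronglyMeasurable b (Eventually.of_forall fun e => hb i e)
  have hint' : Integrable (fun e => Real.exp (η * ξ i e)) κ := by
    refine Integrable.of_bound (by have := hξ i; fun_prop) (Real.exp (η * b))
      (Eventually.of_forall fun e => ?_)
    rw [Real.norm_eq_abs, abs_of_pos (Real.exp_pos _), Real.exp_le_exp]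
    exact mul_le_mul_of_nonneg_left (abs_le.1 (hb i e)).2 hη.le
  rw [← ofReal_integral_eq_lintegral_ofReal hint'
    (Eventually.of_forall fun e => (Real.exp_pos _).le)]
  refine ENNReal.ofReal_le_ofReal ?_
  have hint2 : Integrable (fun e => 1 + η * ξ i e) κ := (integrable_const _).add (hint.const_mul η)
  calc ∫ e, Real.exp (η * ξ i e) ∂κ ≤ ∫ e, (1 + η * ξ i e + η * δ / 2) ∂κ :=
        integral_mono hint' (hint2.add (integrable_const _)) hpt
    _ = 1 + η * ∫ e, ξ i e ∂κ + η * δ / 2 := by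
      rw [integral_add hint2 (integrable_const _), integral_add (integrable_const _)
        (hint.const_mul η), integral_const_mul]
      simp
    _ ≤ 1 - η * δ / 2 := by
      have := mul_le_mul_of_nonneg_left (hmean i) hη.le
      linarith

namespace HybridSystem

variable (M : HybridSystem K m)

lemma sum_Q_mul_eq (f : Fin K → ℝ) (i : Fin K) :
    ∑ j, M.Q i j * f j = ∑ j, M.Q i j * (f j - f i) := by
  simp only [mul_sub, Finset.sum_sub_distrib, ← Finset.sum_mul, M.Q_row_sum, zero_mul, sub_zero]

/-- Harmonic functions of the drift are constant. -/
lemma eq_of_mulVec_eq_zero {f : Fin K → ℝ} (hf : ∀ i, ∑ j, M.Q i j * f j = 0) (i j : Fin K) :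
    f i = f j := by
  have : Nonempty (Fin K) := ⟨⟨0, M.states_pos⟩⟩
  obtain ⟨a, ha⟩ := Finite.exists_max f
  suffices h : ∀ k, f k = f a by rw [h i, h j]
  intro k
  induction M.Q_irreducible a k with
  | refl => rfl
  | @tail b c _ hbc ih =>
    -- Maximum principle: at a maximum these terms are nonpositive with sum zero, so each vanishes
    -- and the maximum propagates along every transition of positive rate.
    have h0 : ∀ l ∈ Finset.univ, M.Q b l * (f l - f b) ≤ 0 := by
      intro l _
      by_cases hl : b = l
      · simp [hl]
      · exact mul_nonpos_of_nonneg_of_nonpos (M.Q_offDiag_nonneg b l hl)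
          (by rw [ih]; linarith [ha l])
    have h1 := hf b
    rw [M.sum_Q_mul_eq, Finset.sum_eq_zero_iff_of_nonpos h0] at h1
    have h2 := (mul_eq_zero.1 (h1 c (Finset.mem_univ c))).resolve_left hbc.2.ne'
    linarith

/-- The Poisson equation of the drift. -/
lemma exists_poisson {w : Fin K → ℝ} (hw : M.IsDriftStationary w) {g : Fin K → ℝ}
    (hg : ∑ θ, w θ * g θ = 0) : ∃ f : Fin K → ℝ, (∀ θ, 0 ≤ f θ) ∧
      ∀ θ, ∑ j, M.Q θ j * f j = g θ := by
  have : Nonempty (Fin K) := ⟨⟨0, M.states_pos⟩⟩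
  set L : (Fin K → ℝ) →ₗ[ℝ] (Fin K → ℝ) := M.Q.mulVecLin
  set W : (Fin K → ℝ) →ₗ[ℝ] ℝ := Fintype.linearCombination ℝ w
  have hL : ∀ f i, L f i = ∑ j, M.Q i j * f j := fun f i => rfl
  have hW : ∀ f, W f = ∑ θ, w θ * f θ := fun f => by
    simp [W, Fintype.linearCombination_apply, mul_comm]
  have hle : LinearMap.range L ≤ LinearMap.ker W := by
    rintro _ ⟨f, rfl⟩
    rw [LinearMap.mem_ker, hW]
    simp only [hL, Finset.mul_sum]
    rw [Finset.sum_comm]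
    refine Finset.sum_eq_zero fun j _ => ?_
    simp only [← mul_assoc, ← Finset.sum_mul, hw.2.2 j, zero_mul]
  have hker : Module.finrank ℝ (LinearMap.ker L) ≤ 1 := by
    have : LinearMap.ker L ≤ Submodule.span ℝ {(fun _ => 1 : Fin K → ℝ)} := by
      intro f hf
      rw [Submodule.mem_span_singleton]
      refine ⟨f ⟨0, M.states_pos⟩, funext fun i => ?_⟩
      simp only [Pi.smul_apply, smul_eq_mul, mul_one]
      refine M.eq_of_mulVec_eq_zero (fun i => ?_) _ _
      rw [← hL, LinearMap.mem_ker.1 hf, Pi.zero_apply]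
    exact (Submodule.finrank_mono this).trans ((finrank_span_le_card _).trans (by simp))
  have hWr : Module.finrank ℝ (LinearMap.range W) = 1 := by
    have : LinearMap.range W = ⊤ := by
      rw [LinearMap.range_eq_top]
      intro y
      refine ⟨fun _ => y, ?_⟩
      rw [hW, ← Finset.sum_mul, hw.2.1, one_mul]
    rw [this, finrank_top, Module.finrank_self]
  -- Rank-nullity: the kernel of `L` has dimension at most one and that of `W` has codimension one,
  -- so the inclusion `hle` cannot be strict.
  have heq : LinearMap.range L = LinearMap.ker W := by
    refine Submodule.eq_of_le_of_finrank_le hle ?_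
    have h1 := L.finrank_range_add_finrank_ker
    have h2 := W.finrank_range_add_finrank_ker
    omega
  have hgW : g ∈ LinearMap.range L := by rw [heq, LinearMap.mem_ker, hW, hg]
  obtain ⟨f, hf⟩ := hgW
  -- Subtracting the minimum makes the solution nonnegative. Constants are harmless because the rows
  -- of `Q` sum to zero.
  obtain ⟨a, ha⟩ := Finite.exists_min f
  refine ⟨fun i => f i - f a, fun i => sub_nonneg.2 (ha i), fun i => ?_⟩
  rw [← hf, hL]
  simp only [mul_sub, Finset.sum_sub_distrib, ← Finset.sum_mul, M.Q_row_sum, zero_mul, sub_zero]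

/-- Change, at the event `e`, of the sum of `f θ` and of the number of forced escalations minus the
number of rings of the service clocks. -/
def increment (ε : ℝ) (f : Fin K → ℝ) (θ : Fin K) (e : Clock K m × ℝ) : ℝ :=
  match e.1 with
  | Sum.inl _ => (Ioi (M.maxThreshold ε θ)).indicator 1 e.2
  | Sum.inr (Sum.inl _) => -1
  | Sum.inr (Sum.inr (i, j)) => if θ = i then f j - f θ else 0

lemma measurable_increment (ε : ℝ) (f : Fin K → ℝ) (θ : Fin K) :
    Measurable (M.increment ε f θ) := by
  refine measurable_from_prod_countable_right fun c => ?_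
  rcases c with _ | _ | ⟨i, j⟩
  · exact measurable_one.indicator measurableSet_Ioi
  · exact measurable_const
  · exact measurable_const

lemma exists_abs_increment_le (ε : ℝ) (f : Fin K → ℝ) :
    ∃ B, ∀ θ e, |M.increment ε f θ e| ≤ B := by
  refine ⟨1 + ∑ i, ∑ j, |f j - f i|, fun θ e => ?_⟩
  have h0 : 0 ≤ ∑ i, ∑ j, |f j - f i| :=
    Finset.sum_nonneg fun i _ => Finset.sum_nonneg fun j _ => abs_nonneg _
  rcases e with ⟨_ | _ | ⟨i, j⟩, s⟩
  · simp only [increment, indicator_apply, Pi.one_apply]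
    split_ifs
    · rw [abs_one]; linarith
    · rw [abs_zero]; linarith
  · simp only [increment, abs_neg, abs_one]
    linarith
  · simp only [increment]
    split_ifs
    · have h1 : |f j - f θ| ≤ ∑ j, |f j - f θ| :=
        Finset.single_le_sum (f := fun j => |f j - f θ|) (fun _ _ => abs_nonneg _)
          (Finset.mem_univ j)
      have h2 : ∑ j, |f j - f θ| ≤ ∑ i, ∑ j, |f j - f i| :=
        Finset.single_le_sum (f := fun i => ∑ j, |f j - f i|)
          (fun _ _ => Finset.sum_nonneg fun _ _ => abs_nonneg _) (Finset.mem_univ θ)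
      linarith
    · rw [abs_zero]; linarith

lemma clockLaw_singleton (c : Clock K m) :
    M.clockLaw {c} = ENNReal.ofReal (M.rate c / M.totalRate) := by
  simp only [clockLaw, Measure.coe_finsetSum, Finset.sum_apply, Measure.smul_apply, smul_eq_mul,
    Measure.dirac_apply, indicator_apply, mem_singleton_iff, Pi.one_apply, mul_ite, mul_one,
    mul_zero, Finset.sum_ite_eq', Finset.mem_univ, if_true]

/-- The score has a density, hence no atom at the threshold. This reconciles the closed half-line in
`lamMin` with the strict inequality in the safety condition. -/
lemma scoreLaw_Ioi (a : ℝ) : M.scoreLaw.real (Ioi a) = M.scoreLaw.real (Ici a) := by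
  have hac : M.scoreLaw ≪ volume :=
    (withDensity_absolutelyContinuous _ _).trans Measure.restrict_le_self.absolutelyContinuous
  exact measureReal_congr (hac.ae_le Ioi_ae_eq_Ici)

/-- If `f` solves the Poisson equation of the drift, the mean increment is constant. -/
lemma integral_increment {ε : ℝ} {f : Fin K → ℝ} {c : ℝ}
    (hf : ∀ θ, ∑ j, M.Q θ j * f j = c - M.lamMin ε θ) (θ : Fin K) :
    ∫ e, M.increment ε f θ e.2 ∂M.markLaw = (c - m * M.mu) / M.totalRate := by
  obtain ⟨B, hB⟩ := M.exists_abs_increment_le ε f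
  have hint : Integrable (M.increment ε f θ) (M.clockLaw.prod M.scoreLaw) :=
    Integrable.of_bound (M.measurable_increment ε f θ).aestronglyMeasurable B
      (Eventually.of_forall fun e => hB θ e)
  have h1 : ∀ c : Clock K m, M.clockLaw.real {c} = M.rate c / M.totalRate := fun c => by
    rw [Measure.real, clockLaw_singleton, ENNReal.toReal_ofReal
      (div_nonneg (M.rate_nonneg c) M.totalRate_pos.le)]
  have h2 : ∫ s, (Ioi (M.maxThreshold ε θ)).indicator (1 : ℝ → ℝ) s ∂M.scoreLaw
      = M.scoreLaw.real (Ici (M.maxThreshold ε θ)) := by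
    rw [integral_indicator_one measurableSet_Ioi, scoreLaw_Ioi]
  -- The drift clocks contribute `(Q f) θ`, whose term `-lamMin` cancels the mean of the forced
  -- escalations. This is what makes the total independent of `θ`.
  have h3 : ∑ x : Fin K × Fin K, M.rate (m := m) (Sum.inr (Sum.inr x)) *
      (if θ = x.1 then f x.2 - f θ else 0) = c - M.lamMin ε θ := by
    rw [← hf θ, M.sum_Q_mul_eq, Fintype.sum_prod_type, Finset.sum_eq_single θ]
    · refine Finset.sum_congr rfl fun j _ => ?_
      simp only [rate, if_true]
      split_ifs with h
      · simp [h]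
      · rfl
    · intro i _ hi
      simp [hi.symm]
    · simp
  rw [markLaw, integral_fun_snd, integral_prod _ hint, integral_fintype (hint.integral_prod_left)]
  simp only [probReal_univ, one_mul, h1, Fintype.sum_sum_type, increment, smul_eq_mul, h2,
    integral_const]
  simp only [div_mul_eq_mul_div, ← Finset.sum_div]
  rw [h3]
  simp only [rate, lamMin, Finset.sum_const, Finset.card_univ, Fintype.card_fin,
    Fintype.card_unit, nsmul_eq_mul]
  ring

end HybridSystem

/-! ### The unstable region -/

namespace HybridSystem

variable (M : HybridSystem K m)

/-- The reliability state, together with the number of forced escalations minus the number of rings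
of the service clocks: the queue of an `ε`-safe policy is at least as long. -/
def netMap (ε : ℝ) (e : Clock K m × ℝ) (y : Fin K × ℤ) : Fin K × ℤ :=
  match e.1 with
  | Sum.inl _ => (y.1, y.2 + (Ioi (M.maxThreshold ε y.1)).indicator 1 e.2)
  | Sum.inr (Sum.inl _) => (y.1, y.2 - 1)
  | Sum.inr (Sum.inr (i, j)) => if y.1 = i then (j, y.2) else y

lemma measurable_netMap (ε : ℝ) :
    Measurable (Function.uncurry fun e : Mark K m => M.netMap ε e.2) := by
  have h : Measurable fun z : (Clock K m × (Fin K × ℤ)) × ℝ => M.netMap ε (z.1.1, z.2) z.1.2 := by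
    refine measurable_from_prod_countable_right fun z => ?_
    obtain ⟨c, θ, k⟩ := z
    rcases c with _ | _ | ⟨i, j⟩
    · have h : Measurable fun s : ℝ => k + (Ioi (M.maxThreshold ε θ)).indicator (1 : ℝ → ℤ) s :=
        measurable_const.add (measurable_one.indicator measurableSet_Ioi)
      exact measurable_const.prodMk h
    · exact measurable_const (a := (θ, k - 1))
    · exact measurable_const (a := if θ = i then (j, k) else (θ, k))
  exact h.comp (f := fun z : Mark K m × (Fin K × ℤ) => ((z.1.2.1, z.2), z.1.2.2)) (by fun_prop)

/-- With the correction `f`, the net count becomes a walk with increments of constant mean. -/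
lemma netMap_eq_add_increment (ε : ℝ) (f : Fin K → ℝ) (e : Clock K m × ℝ) (y : Fin K × ℤ) :
    ((M.netMap ε e y).2 : ℝ) + f (M.netMap ε e y).1 = y.2 + f y.1 + M.increment ε f y.1 e := by
  rcases e with ⟨_ | _ | ⟨i, j⟩, s⟩
  · simp only [netMap, increment, indicator_apply, Pi.one_apply]
    split_ifs <;> push_cast <;> ring
  · simp only [netMap, increment]
    push_cast
    ring
  · simp only [netMap, increment]
    split_ifs <;> simp

/-- In the unstable region, the forced escalations exceed the service capacity by an amount that
tends to infinity. -/
lemma ae_tendsto_netMap {ε : ℝ} {w : Fin K → ℝ} (hw : M.IsDriftStationary w)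
    (hcap : m * M.mu < M.requiredCapacity ε w) (y : Fin K × ℤ) :
    ∀ᵐ ω ∂M.prob, Tendsto (fun n => (forwardIter (fun e => M.netMap ε e.2) y ω n).2)
      atTop atTop := by
  obtain ⟨f, -, hf⟩ := M.exists_poisson hw
    (g := fun θ => M.requiredCapacity ε w - M.lamMin ε θ) (by
      simp only [mul_sub, Finset.sum_sub_distrib, ← Finset.sum_mul, hw.2.1, one_mul]
      exact sub_self _)
  obtain ⟨B, hB⟩ := M.exists_abs_increment_le ε f
  obtain ⟨η, hη, ρ, hρ, hexp⟩ := exists_lintegral_exp_le M.markLaw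
    (ξ := fun θ (e : Mark K m) => -M.increment ε f θ e.2) (B := B)
    (fun θ => ((M.measurable_increment ε f θ).comp measurable_snd).neg)
    (fun θ e => by rw [abs_neg]; exact hB θ e.2)
    (div_pos (sub_pos.2 hcap) M.totalRate_pos)
    (fun θ => by rw [integral_neg, M.integral_increment hf])
  -- The corrected count has positive mean increments, so the exponential of a small negative
  -- multiple of it is contracted.
  have hlim := ae_tendsto_zero_of_transition_le (M.measurable_netMap ε) M.markLaw
    (g := fun y => ENNReal.ofReal (Real.exp (-(η * (y.2 + f y.1))))) .of_discrete hρ (fun y => by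
      have hm : Measurable fun e : Mark K m =>
          ENNReal.ofReal (Real.exp (η * -M.increment ε f y.1 e.2)) := by
        have h : Measurable fun e : Mark K m => M.increment ε f y.1 e.2 :=
          (M.measurable_increment ε f y.1).comp measurable_snd
        exact ((h.neg.const_mul η).exp).ennreal_ofReal
      rw [transition, mul_comm]
      refine le_trans (le_of_eq ?_) (mul_le_mul_right (hexp y.1) _)
      rw [← lintegral_const_mul _ hm]
      refine lintegral_congr fun e => ?_
      rw [← ENNReal.ofReal_mul (Real.exp_nonneg _), ← Real.exp_add, M.netMap_eq_add_increment]
      ring_nf) y (by simp)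
  filter_upwards [hlim] with ω h2
  have h3 := (ENNReal.tendsto_toReal ENNReal.zero_ne_top).comp h2
  simp only [Function.comp_def, ENNReal.toReal_ofReal (Real.exp_nonneg _), ENNReal.toReal_zero,
    Real.tendsto_exp_comp_nhds_zero, tendsto_neg_atBot_iff] at h3
  have h4 := (tendsto_const_mul_atTop_of_pos hη).1 h3
  -- The correction takes finitely many values, so it does not affect divergence.
  obtain ⟨F, hF⟩ := Finite.bddAbove_range f
  rw [← tendsto_intCast_atTop_iff (R := ℝ)]
  refine tendsto_atTop_mono (fun n => ?_) (tendsto_atTop_add_const_right _ (-F) h4)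
  have := hF (mem_range_self (forwardIter (fun e => M.netMap ε e.2) y ω n).1)
  linarith

/-- As long as the policy does not automate a task above the threshold, the queue is bounded below
by the net number of forced escalations. -/
lemma netMap_le_chain {ε : ℝ} {p : Policy K m} {x₀ : State K} {ω : ℕ → Mark K m}
    (hω : ω ∉ M.unsafeEvent ε p x₀) (n : ℕ) :
    (forwardIter (fun e => M.netMap ε e.2) (x₀.2, (x₀.1 : ℤ)) ω n).1 = (p.chain x₀ ω n).2 ∧
    (forwardIter (fun e => M.netMap ε e.2) (x₀.2, (x₀.1 : ℤ)) ω n).2 ≤ (p.chain x₀ ω n).1 := by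
  induction n with
  | zero => exact ⟨rfl, le_rfl⟩
  | succ n ih =>
    have hsafe : (ω n).2.1 = Sum.inl () → M.maxThreshold ε (p.chain x₀ ω n).2 < (ω n).2.2 →
        p.action ω n (p.chain x₀ ω n) = true := by
      intro h1 h2
      by_contra h3
      exact hω ⟨n, h1, h2, by simpa using h3⟩
    simp only [forwardIter, Policy.chain]
    generalize forwardIter (fun e => M.netMap ε e.2) (x₀.2, (x₀.1 : ℤ)) ω n = y at ih ⊢
    generalize p.action ω n (p.chain x₀ ω n) = a at hsafe ⊢
    generalize p.chain x₀ ω n = x at ih hsafe ⊢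
    generalize (ω n).2 = e at hsafe ⊢
    obtain ⟨θ, k⟩ := y
    obtain ⟨q, θ'⟩ := x
    obtain ⟨h1, h2⟩ := ih
    simp only at h1 h2
    subst h1
    rcases e with ⟨_ | j | ⟨i, j⟩, s⟩
    · simp only [netMap, step, indicator_apply, Pi.one_apply, mem_Ioi]
      -- Voluntary escalations below the threshold only lengthen the queue. The one harmful case,
      -- automation above the threshold, is excluded by safety.
      split_ifs with h3 h4 h4
      · exact ⟨rfl, by push_cast; linarith⟩
      · exact ⟨rfl, by push_cast; linarith⟩
      · exact absurd (hsafe rfl h4) h3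
      · exact ⟨rfl, by linarith⟩
    · simp only [netMap, step]
      -- A ring of an idle expert lowers the net count but not the queue, which preserves the
      -- inequality.
      split_ifs with h3
      · exact ⟨rfl, by simp only; omega⟩
      · exact ⟨rfl, by simp only; omega⟩
    · simp only [netMap, step]
      split_ifs with h3
      · exact ⟨rfl, h2⟩
      · exact ⟨rfl, h2⟩

/-- In the unstable region, every policy that is almost surely `ε`-safe is unstable. -/
theorem isUnstable_of_capacity_lt {ε : ℝ} {w : Fin K → ℝ} (hw : M.IsDriftStationary w)
    (hcap : m * M.mu < M.requiredCapacity ε w) (p : Policy K m) (x₀ : State K)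
    (hsafe : M.prob (M.unsafeEvent ε p x₀) = 0) : M.IsUnstable p x₀ := by
  intro k
  have hev : ∀ᵐ ω ∂M.prob, ∀ᶠ t in atTop, ω ∉ {ω | ¬ k < (p.process x₀ t ω).1} := by
    filter_upwards [M.ae_isRegular, M.ae_tendsto_netMap hw hcap (x₀.2, (x₀.1 : ℤ)),
      measure_eq_zero_iff_ae_notMem.1 hsafe] with ω hω hlim hs
    filter_upwards [hω.tendsto_eventCount.eventually (hlim.eventually_gt_atTop (k : ℤ))] with t ht
    have := (M.netMap_le_chain hs (eventCount ω t)).2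
    refine not_not.2 ?_
    rw [Policy.process]
    omega
  have hmeas : ∀ t, 0 ≤ t → NullMeasurableSet {ω | ¬ k < (p.process x₀ t ω).1} M.prob :=
    fun t ht => (M.aemeasurable_process p x₀ ht).nullMeasurable
      (MeasurableSet.of_discrete (s := {x : State K | ¬ k < x.1}))
  have h0 := tendsto_measure_zero_of_ae_eventually_notMem
    ((eventually_ge_atTop (0 : ℝ)).mono hmeas) hev
  have h1 := ENNReal.Tendsto.sub (tendsto_const_nhds (x := (1 : ℝ≥0∞))) h0
    (Or.inl ENNReal.one_ne_top)
  rw [tsub_zero] at h1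
  refine h1.congr' ?_
  filter_upwards [eventually_ge_atTop 0] with t ht
  rw [law, Measure.map_apply_of_aemeasurable (M.aemeasurable_process p x₀ ht) .of_discrete,
    ← prob_compl_eq_one_sub₀ (hmeas t ht)]
  congr 1
  ext ω
  simp

end HybridSystem

/-! ### Mean meeting time of two coupled trajectories -/

section MeetingTime

variable {E X : Type*} [MeasurableSpace E] [MeasurableSpace X] [MeasurableSingletonClass X]
  [Countable X] {φ : E → X → X} (hφ : Measurable (Function.uncurry φ)) (κ : Measure E)
  [IsProbabilityMeasure κ]

/-- The probability that two trajectories with the same randomness have not met after `n` steps. -/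
def apartProb (φ : E → X → X) (n : ℕ) (z : X × X) : ℝ≥0∞ :=
  (transition κ (coupledMap φ))^[n] offDiag z

include hφ

/-- Trajectories driven by the same randomness stay together once they have met. -/
lemma apartProb_antitone (z : X × X) : Antitone fun n => apartProb κ φ n z := by
  refine antitone_nat_of_succ_le fun n => ?_
  rw [apartProb, apartProb, ← lintegral_forwardIter (measurable_coupledMap hφ) κ .of_discrete,
    ← lintegral_forwardIter (measurable_coupledMap hφ) κ .of_discrete]
  refine lintegral_mono fun ω => ?_
  rw [forwardIter]
  obtain ⟨x, y⟩ := forwardIter (coupledMap φ) z ω n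
  by_cases h : x = y
  · subst h; simp [coupledMap]
  · rw [offDiag_of_ne h]; exact offDiag_le_one _

lemma apartProb_le_offDiag (n : ℕ) (z : X × X) : apartProb κ φ n z ≤ offDiag z :=
  apartProb_antitone hφ κ z (Nat.zero_le n)

lemma apartProb_le_one (n : ℕ) (z : X × X) : apartProb κ φ n z ≤ 1 :=
  (apartProb_le_offDiag hφ κ n z).trans (offDiag_le_one z)

/-- Two trajectories can meet if with positive probability they move to a pair of states from which
they can meet. -/
lemma exists_apartProb_lt_one_of_move {A : Set E} (hA : MeasurableSet A) (hκ : κ A ≠ 0)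
    {z z' : X × X} (hz : ∀ e ∈ A, coupledMap φ e z = z') (h : ∃ n, apartProb κ φ n z' < 1) :
    ∃ n, apartProb κ φ n z < 1 := by
  obtain ⟨n, hn⟩ := h
  refine ⟨n + 1, ?_⟩
  calc apartProb κ φ (n + 1) z = ∫⁻ e, apartProb κ φ n (coupledMap φ e z) ∂κ := by
        rw [apartProb, Function.iterate_succ_apply']; rfl
    _ ≤ ∫⁻ e, (A.indicator (fun _ => apartProb κ φ n z') e + Aᶜ.indicator (fun _ => 1) e) ∂κ := by
        refine lintegral_mono fun e => ?_
        by_cases he : e ∈ A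
        · simp [he, hz e he]
        · simpa [he] using apartProb_le_one hφ κ n _
    _ = apartProb κ φ n z' * κ A + κ Aᶜ := by
        rw [lintegral_add_left (measurable_const.indicator hA), lintegral_indicator_const hA,
          lintegral_indicator_const hA.compl, one_mul]
    _ < 1 * κ A + κ Aᶜ := by
        refine ENNReal.add_lt_add_right (measure_ne_top κ _) ?_
        exact ENNReal.mul_lt_mul_left hκ (measure_ne_top κ _) hn
    _ = 1 := by rw [one_mul, measure_add_measure_compl hA, measure_univ]

/-- If the random map satisfies a geometric drift condition and trajectories can meet from each pair
of states, the mean meeting time has a Lyapunov function. -/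
lemma exists_coupling_lyapunov {V : X → ℝ≥0∞} {r C : ℝ≥0∞} (hr : r ≤ 1)
    (hC : C ≠ ∞) (hdrift : ∀ x, transition κ φ V x ≤ r * V x + C) (S : Finset (X × X))
    (hS : ∀ z ∉ S, r * (V z.1 + V z.2) + (2 * C + 1) ≤ V z.1 + V z.2)
    (hmeet : ∀ z ∈ S, ∃ n, apartProb κ φ n z < 1) :
    ∃ H : X × X → ℝ≥0∞, ∃ b : ℝ≥0∞, b ≠ ∞ ∧ (∀ z, H z ≤ V z.1 + V z.2 + b) ∧
      ∀ z, transition κ (coupledMap φ) H z + offDiag z ≤ H z := by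
  -- Since `S` is finite, there is a common horizon `L` within which every pair in `S` meets with
  -- probability at least `p > 0`.
  choose! N hN using hmeet
  set L := S.sup N
  have hL : ∀ z ∈ S, apartProb κ φ L z < 1 := fun z hz =>
    (apartProb_antitone hφ κ z (Finset.le_sup hz)).trans_lt (hN z hz)
  set s := S.sup (apartProb κ φ L)
  have hs : s < 1 := (Finset.sup_lt_iff (by simp)).2 hL
  set p := 1 - s
  have hp : p ≠ 0 := (tsub_pos_of_lt hs).ne'
  have hLp : ∀ z ∈ S, apartProb κ φ L z + p ≤ 1 := fun z hz => by
    calc apartProb κ φ L z + p ≤ s + p := by gcongr; exact Finset.le_sup hz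
      _ = 1 := add_tsub_cancel_of_le hs.le
  -- On `S` the gain `B * p` has to pay for the drift constants `2 * C` and the unit cost of being
  -- apart.
  set B := (2 * C + 1) / p
  have hBp : B * p = 2 * C + 1 := ENNReal.div_mul_cancel hp (by finiteness)
  have hB : B ≠ ∞ := ENNReal.div_ne_top (by finiteness) hp
  -- The expected time apart during the first `L` steps. By telescoping, off the diagonal one step
  -- never increases it, and on `S` lowers it by at least `p`.
  set h : X × X → ℝ≥0∞ := fun z => ∑ k ∈ Finset.range L, apartProb κ φ k z
  have hhL : ∀ z, h z ≤ L := fun z => by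
    calc h z ≤ ∑ k ∈ Finset.range L, 1 := Finset.sum_le_sum fun k _ => apartProb_le_one hφ κ k z
      _ = L := by simp
  have hmove : ∀ (g : X × X → ℝ≥0∞) z, Measurable fun e => g (coupledMap φ e z) := fun g z =>
    (Measurable.of_discrete (f := g)).comp
      ((measurable_coupledMap hφ).comp (measurable_id.prodMk measurable_const))
  have hh : ∀ z, transition κ (coupledMap φ) h z + offDiag z = h z + apartProb κ φ L z := by
    intro z
    have h1 : transition κ (coupledMap φ) h z
        = ∑ k ∈ Finset.range L, apartProb κ φ (k + 1) z := by
      simp only [transition, h]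
      rw [lintegral_finsetSum _ fun k _ => hmove _ z]
      refine Finset.sum_congr rfl fun k _ => ?_
      rw [apartProb, Function.iterate_succ_apply']; rfl
    rw [h1]
    exact (Finset.sum_range_succ' (fun k => apartProb κ φ k z) L).symm.trans
      (Finset.sum_range_succ _ _)
  have happ : ∀ z, apartProb κ φ L z ≠ ∞ := fun z =>
    ne_top_of_le_ne_top ENNReal.one_ne_top (apartProb_le_one hφ κ L z)
  -- The factor `offDiag` makes the function vanish on the diagonal, where the additive constants of
  -- the drift would otherwise not be paid for.
  set W : X × X → ℝ≥0∞ := fun z => offDiag z * (V z.1 + V z.2)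
  have hH : ∀ z, transition κ (coupledMap φ) (fun z => W z + B * h z) z
      = transition κ (coupledMap φ) W z + B * transition κ (coupledMap φ) h z := by
    intro z
    rw [transition, lintegral_add_left (hmove W z), lintegral_const_mul _ (hmove h z)]
    rfl
  refine ⟨fun z => W z + B * h z, B * L, by finiteness, fun z => ?_, fun z => ?_⟩
  · exact add_le_add (mul_le_of_le_one_left zero_le (offDiag_le_one z))
      (mul_le_mul_right (hhL z) B)
  rw [hH]
  obtain ⟨x, y⟩ := z
  by_cases hxy : x = y
  · subst hxy
    have h1 : transition κ (coupledMap φ) W (x, x) = 0 := by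
      simp [transition, W, coupledMap]
    have h2 := hh (x, x)
    have h3 : apartProb κ φ L (x, x) = 0 :=
      le_antisymm ((apartProb_le_offDiag hφ κ L _).trans (offDiag_self x).le) zero_le
    rw [h3, offDiag_self, add_zero, add_zero] at h2
    rw [h1, h2, offDiag_self, zero_add, add_zero]
    exact le_add_self
  · have hW : transition κ (coupledMap φ) W (x, y) ≤ r * (V x + V y) + 2 * C := by
      calc transition κ (coupledMap φ) W (x, y) ≤ ∫⁻ e, (V (φ e x) + V (φ e y)) ∂κ :=
            lintegral_mono fun e => mul_le_of_le_one_left zero_le (offDiag_le_one _)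
        _ = transition κ φ V x + transition κ φ V y :=
            lintegral_add_left (Measurable.comp .of_discrete
              (hφ.comp (measurable_id.prodMk measurable_const))) _
        _ ≤ (r * V x + C) + (r * V y + C) := add_le_add (hdrift x) (hdrift y)
        _ = r * (V x + V y) + 2 * C := by ring
    have h2 := hh (x, y)
    rw [offDiag_of_ne hxy] at h2 ⊢
    have hWxy : W (x, y) = V x + V y := by simp only [W, offDiag_of_ne hxy, one_mul]
    change _ ≤ W (x, y) + B * h (x, y)
    rw [hWxy]
    by_cases hz : (x, y) ∈ S
    · have h3 : p + transition κ (coupledMap φ) h (x, y) ≤ h (x, y) := by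
        refine (ENNReal.add_le_add_iff_right (happ (x, y))).1 ?_
        rw [← h2]
        calc _ = transition κ (coupledMap φ) h (x, y) + (apartProb κ φ L (x, y) + p) := by ring
          _ ≤ _ := by gcongr; exact hLp _ hz
      calc _ ≤ r * (V x + V y) + 2 * C + B * transition κ (coupledMap φ) h (x, y) + 1 := by
            gcongr
        _ = r * (V x + V y) + (2 * C + 1) + B * transition κ (coupledMap φ) h (x, y) := by ring
        _ ≤ 1 * (V x + V y) + B * p + B * transition κ (coupledMap φ) h (x, y) := by
            rw [hBp]; gcongr
        _ = V x + V y + B * (p + transition κ (coupledMap φ) h (x, y)) := by ring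
        _ ≤ _ := by gcongr
    · have h3 : transition κ (coupledMap φ) h (x, y) ≤ h (x, y) := by
        refine (ENNReal.add_le_add_iff_right ENNReal.one_ne_top).1 ?_
        rw [h2]
        gcongr
        exact apartProb_le_one hφ κ L _
      calc _ ≤ r * (V x + V y) + 2 * C + B * h (x, y) + 1 := by gcongr
        _ = r * (V x + V y) + (2 * C + 1) + B * h (x, y) := by ring
        _ ≤ _ := add_le_add (hS _ hz) le_rfl

end MeetingTime

/-! ### The stable region -/

lemma StationaryPolicy.map_fst_le (p : StationaryPolicy K) (e : Clock K m × ℝ) (x : State K) :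
    (p.map e x).1 ≤ x.1 + 1 := by
  rcases e with ⟨_ | _ | ⟨i, j⟩, s⟩ <;> simp only [map, step] <;> split_ifs <;> omega

namespace HybridSystem

variable (M : HybridSystem K m)

lemma markLaw_clock_ne_zero {c : Clock K m} (hc : 0 < M.rate c) :
    M.markLaw {e | e.2.1 = c} ≠ 0 := by
  have : {e : Mark K m | e.2.1 = c} = univ ×ˢ ({c} ×ˢ univ) := by ext e; simp
  rw [this, markLaw, Measure.prod_prod, Measure.prod_prod, measure_univ, measure_univ, one_mul,
    mul_one, clockLaw_singleton]
  exact (ENNReal.ofReal_pos.2 (div_pos hc M.totalRate_pos)).ne'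

/-- Under a stationary policy, trajectories with the same randomness can meet. -/
lemma exists_apartProb_lt_one (p : StationaryPolicy K) (z : State K × State K) :
    ∃ n, apartProb M.markLaw (fun e => p.map e.2) n z < 1 := by
  have hφ := p.measurable_markMap (m := m)
  -- Only rings whose effect does not depend on the actions are used, so the argument avoids
  -- arrivals and holds for every policy.
  have hmove : ∀ (c : Clock K m) (z z' : State K × State K), 0 < M.rate c →
      (∀ a a', (step a c z.1, step a' c z.2) = z') →
      (∃ n, apartProb M.markLaw (fun e => p.map e.2) n z' < 1) →
      ∃ n, apartProb M.markLaw (fun e => p.map e.2) n z < 1 := by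
    intro c z z' hc hz
    refine exists_apartProb_lt_one_of_move hφ M.markLaw ?_ (M.markLaw_clock_ne_zero hc) ?_
    · exact measurable_snd.fst (measurableSet_singleton c)
    · intro e he
      rw [← hz (p.act z.1.1 z.1.2 e.2.2) (p.act z.2.1 z.2.2 e.2.2), ← (he : e.2.1 = c)]
      rfl
  -- With both queues empty, the first reliability state follows a path to `j`. Until it arrives
  -- there, the second does not react, since each ring moves only a process in the state `a ≠ j`.
  have hdrift : ∀ i j : Fin K, ∃ n,
      apartProb M.markLaw (fun e => p.map e.2) n ((0, i), (0, j)) < 1 := by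
    intro i j
    induction M.Q_irreducible i j using Relation.ReflTransGen.head_induction_on with
    | refl => exact ⟨0, by simp [apartProb]⟩
    | @head a b hab _ ih =>
      by_cases haj : a = j
      · subst haj; exact ⟨0, by simp [apartProb]⟩
      · refine hmove (Sum.inr (Sum.inr (a, b))) _ ((0, b), (0, j)) ?_ ?_ ih
        · simpa [rate, hab.1] using hab.2
        · intro _ _
          simp [step, Ne.symm haj]
  -- Repeated rings of expert `0`, who is busy whenever a task is present, empty both queues; rings
  -- at an empty queue do nothing.
  have hdrain : ∀ N q q' : ℕ, ∀ i j : Fin K, q ≤ N → q' ≤ N → ∃ n,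
      apartProb M.markLaw (fun e => p.map e.2) n ((q, i), (q', j)) < 1 := by
    intro N
    induction N with
    | zero =>
      intro q q' i j hq hq'
      obtain rfl := Nat.le_zero.1 hq
      obtain rfl := Nat.le_zero.1 hq'
      exact hdrift i j
    | succ N ih =>
      intro q q' i j hq hq'
      refine hmove (Sum.inr (Sum.inl ⟨0, M.servers_pos⟩)) _ ((q - 1, i), (q' - 1, j)) M.mu_pos ?_
        (ih _ _ i j (by omega) (by omega))
      intro _ _
      simp only [step]
      split_ifs with h1 h2 h2
      · rfl
      · obtain rfl : q' = 0 := by simpa using h2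
        rfl
      · obtain rfl : q = 0 := by simpa using h1
        rfl
      · obtain rfl : q' = 0 := by simpa using h2
        obtain rfl : q = 0 := by simpa using h1
        rfl
  obtain ⟨⟨q, i⟩, ⟨q', j⟩⟩ := z
  exact hdrain (max q q') q q' i j (le_max_left _ _) (le_max_right _ _)

/-- The policy that escalates exactly the tasks with a score above the maximum permissible
threshold. -/
def thresholdPolicy (ε : ℝ) : StationaryPolicy K where
  act _ θ s := decide (M.maxThreshold ε θ < s)
  measurable_act _ _ := measurable_to_bool (by
    simp only [preimage, mem_singleton_iff, decide_eq_true_eq]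
    exact measurableSet_Ioi)

lemma isSafe_thresholdPolicy (ε : ℝ) : M.IsSafe ε (M.thresholdPolicy ε) :=
  fun _ _ _ _ h => decide_eq_true h

/-- When all servers are busy, the threshold policy changes the queue by exactly the increment. -/
lemma map_thresholdPolicy_eq (ε : ℝ) (f : Fin K → ℝ) (e : Clock K m × ℝ) {x : State K}
    (hx : m ≤ x.1) :
    (((M.thresholdPolicy ε).map e x).1 : ℝ) + f ((M.thresholdPolicy ε).map e x).2
      = x.1 + f x.2 + M.increment ε f x.2 e := by
  rcases e with ⟨_ | k | ⟨i, j⟩, s⟩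
  · simp only [StationaryPolicy.map, thresholdPolicy, step, increment, indicator_apply, mem_Ioi,
      Pi.one_apply, decide_eq_true_eq]
    split_ifs <;> push_cast <;> ring
  · have hk : (k : ℕ) < x.1 := k.2.trans_le hx
    simp only [StationaryPolicy.map, step, increment, if_pos hk]
    rw [Nat.cast_sub (by omega)]
    push_cast
    ring
  · simp only [StationaryPolicy.map, step, increment]
    split_ifs <;> simp

/-- In the stable region, the threshold policy has a finite mean queue. -/
theorem hasFiniteMeanQueue_thresholdPolicy {ε : ℝ} {w : Fin K → ℝ} (hw : M.IsDriftStationary w)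
    (hcap : M.requiredCapacity ε w < m * M.mu) :
    M.HasFiniteMeanQueue (M.thresholdPolicy ε) := by
  set p := M.thresholdPolicy ε
  obtain ⟨f, hf0, hf⟩ := M.exists_poisson hw
    (g := fun θ => M.requiredCapacity ε w - M.lamMin ε θ) (by
      simp only [mul_sub, Finset.sum_sub_distrib, ← Finset.sum_mul, hw.2.1, one_mul]
      exact sub_self _)
  obtain ⟨B, hB⟩ := M.exists_abs_increment_le ε f
  obtain ⟨η, hη, ρ, hρ, hexp⟩ := exists_lintegral_exp_le M.markLaw
    (ξ := fun θ (e : Mark K m) => M.increment ε f θ e.2) (B := B)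
    (fun θ => (M.measurable_increment ε f θ).comp measurable_snd)
    (fun θ e => hB θ e.2) (div_pos (sub_pos.2 hcap) M.totalRate_pos)
    (fun θ => by rw [M.integral_increment hf, ← neg_div, neg_sub])
  obtain ⟨F, hF⟩ := Finite.bddAbove_range f
  -- The factor `η⁻¹` lets `1 + x ≤ exp x`, with `f ≥ 0`, give `q ≤ V`.
  set V : State K → ℝ≥0∞ := fun x => ENNReal.ofReal (η⁻¹ * Real.exp (η * (x.1 + f x.2)))
  have hqV : ∀ x : State K, (x.1 : ℝ≥0∞) ≤ V x := by
    intro x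
    rw [← ENNReal.ofReal_natCast]
    refine ENNReal.ofReal_le_ofReal ?_
    rw [inv_mul_eq_div, le_div_iff₀ hη]
    have h1 := Real.add_one_le_exp (η * (x.1 + f x.2))
    have h2 := mul_nonneg hη.le (hf0 x.2)
    nlinarith
  -- If fewer than `m` tasks are present, at most `m` are present after one event, and then `V` is
  -- at most this constant.
  set C : ℝ≥0∞ := ENNReal.ofReal (η⁻¹ * Real.exp (η * (m + F)))
  have hdrift : ∀ x, M.kernel p V x ≤ ρ * V x + C := by
    intro x
    by_cases hx : m ≤ x.1
    · have hm : Measurable fun e : Mark K m =>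
          ENNReal.ofReal (Real.exp (η * M.increment ε f x.2 e.2)) := by
        have h : Measurable fun e : Mark K m => M.increment ε f x.2 e.2 :=
          (M.measurable_increment ε f x.2).comp measurable_snd
        exact ((h.const_mul η).exp).ennreal_ofReal
      refine le_trans ?_ le_self_add
      rw [kernel, transition, mul_comm]
      refine le_trans (le_of_eq ?_) (mul_le_mul_right (hexp x.2) _)
      rw [← lintegral_const_mul _ hm]
      refine lintegral_congr fun e => ?_
      rw [← ENNReal.ofReal_mul (by positivity), mul_assoc, ← Real.exp_add]
      simp only [V, p, M.map_thresholdPolicy_eq ε f e.2 hx]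
      ring_nf
    · refine le_trans ?_ le_add_self
      calc M.kernel p V x ≤ ∫⁻ _e, C ∂M.markLaw := by
            refine lintegral_mono fun e => ENNReal.ofReal_le_ofReal ?_
            have h1 : ((p.map e.2 x).1 : ℝ) ≤ m := by
              exact_mod_cast (p.map_fst_le e.2 x).trans (by omega)
            have h2 := hF (mem_range_self (p.map e.2 x).2)
            gcongr
        _ = C := by simp
  have hV : ∀ x, V x ≠ ∞ := fun x => ENNReal.ofReal_ne_top
  have hC : C ≠ ∞ := ENNReal.ofReal_ne_top
  have hρ0 : 1 - ρ ≠ 0 := (tsub_pos_of_lt hρ).ne'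
  -- If one of the queues has at least `N` tasks, then `(1 - ρ) * (V z.1 + V z.2)` exceeds `2 * C +
  -- 1`, so only finitely many pairs need the meeting argument.
  obtain ⟨N, hN⟩ := ENNReal.exists_nat_gt
    (ENNReal.div_ne_top (by finiteness : 2 * C + 1 ≠ ∞) hρ0)
  set S : Finset (State K × State K) :=
    (Finset.range N ×ˢ Finset.univ) ×ˢ (Finset.range N ×ˢ Finset.univ)
  have hS : ∀ z ∉ S, ρ * (V z.1 + V z.2) + (2 * C + 1) ≤ V z.1 + V z.2 := by
    intro z hz
    have hNz : (N : ℝ≥0∞) ≤ V z.1 + V z.2 := by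
      simp only [S, Finset.mem_product, Finset.mem_range, Finset.mem_univ, and_true, not_and_or,
        not_lt] at hz
      rcases hz with h | h
      · exact (Nat.cast_le.2 h).trans ((hqV z.1).trans le_self_add)
      · exact (Nat.cast_le.2 h).trans ((hqV z.2).trans le_add_self)
    calc ρ * (V z.1 + V z.2) + (2 * C + 1)
        = ρ * (V z.1 + V z.2) + (1 - ρ) * ((2 * C + 1) / (1 - ρ)) := by
          rw [ENNReal.mul_div_cancel hρ0 (by finiteness)]
      _ ≤ ρ * (V z.1 + V z.2) + (1 - ρ) * (V z.1 + V z.2) := by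
          gcongr
          exact hN.le.trans hNz
      _ = V z.1 + V z.2 := by rw [← add_mul, add_tsub_cancel_of_le hρ.le, one_mul]
  have hφ := p.measurable_markMap (m := m)
  obtain ⟨H, b, hb, hHle, hH⟩ := exists_coupling_lyapunov hφ M.markLaw hρ.le hC hdrift S hS
    fun z _ => M.exists_apartProb_lt_one p z
  refine M.hasFiniteMeanQueue_of_drift p hV hqV hρ hC hdrift
    (fun z => ne_top_of_le_ne_top (by have := hV z.1; have := hV z.2; finiteness) (hHle z)) hH
    (0, ⟨0, M.states_pos⟩) ?_
  set x₀ : State K := (0, ⟨0, M.states_pos⟩)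
  have hV0 := hV x₀
  refine ne_top_of_le_ne_top (b := V x₀ + (ρ * V x₀ + C) + b) (by have := hρ.ne_top; finiteness) ?_
  calc ∫⁻ e, H (x₀, p.map e.2 x₀) ∂M.markLaw
      ≤ ∫⁻ e, (V x₀ + V (p.map e.2 x₀) + b) ∂M.markLaw := lintegral_mono fun e => hHle _
    _ = V x₀ + M.kernel p V x₀ + b := by
        rw [lintegral_add_right _ measurable_const, lintegral_add_left measurable_const]
        simp [kernel, transition]
    _ ≤ _ := by gcongr; exact hdrift x₀

end HybridSystem

end HybridQueue

end

/-! ### The phase transition -/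

theorem theorem4 {K m : ℕ} (M : HybridQueue.HybridSystem K m) (ε : ℝ) (hε : 0 ≤ ε)
    (w : Fin K → ℝ) (hw : M.IsDriftStationary w) :
    (M.requiredCapacity ε w < m * M.mu →
      ∃ p : HybridQueue.StationaryPolicy K, M.IsSafe ε p ∧ M.HasFiniteMeanQueue p) ∧
    (m * M.mu < M.requiredCapacity ε w →
      ∀ (p : HybridQueue.Policy K m) (x₀ : HybridQueue.State K),
        M.IsUnstable p x₀ ∨ 0 < M.prob (M.unsafeEvent ε p x₀)) := by
  refine ⟨fun hcap => ⟨M.thresholdPolicy ε, M.isSafe_thresholdPolicy ε,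
    M.hasFiniteMeanQueue_thresholdPolicy hw hcap⟩, fun hcap p x₀ => ?_⟩
  rcases eq_or_ne (M.prob (M.unsafeEvent ε p x₀)) 0 with h | h
  · exact Or.inl (M.isUnstable_of_capacity_lt hw hcap p x₀ h)
  · exact Or.inr (pos_iff_ne_zero.2 h)
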